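/- Let $\mathsf{E\text{-}PA}^{\omega*}$ be Peano arithmetic in all finite types with the axiom of extensionality and with types $\sigma^*$ of finite sequences. Let $\mathsf{P}$ be the classical system obtained from it by adding - a predicate $\mathrm{st}$ ("is standard") at every type, with the axioms $\mathrm{st}(x)\wedge x=y\to\mathrm{st}(y)$, $\mathrm{st}(r)$ for every closed term $r$, and $\mathrm{st}(f)\wedge\mathrm{st}(x)\to\mathrm{st}(f(x))$; - external induction: $\Phi(0)\wedge(\forall^{\mathrm{st}}n)(\Phi(n)\to\Phi(n+1))\to(\forall^{\mathrm{st}}n)\Phi(n)$ for every formula $\Phi$; - idealisation, for internal ($\mathrm{st}$-free) $\varphi$: $(\forall^{\mathrm{st}}x^{\sigma^*})(\exists y^\tau)(\forall z^\sigma\in x)\varphi(z,y)\to(\exists y^\tau)(\forall^{\mathrm{st}}x^\sigma)\varphi(x,y)$; - herbrandised choice, for internal $\varphi$: $(\forall^{\mathrm{st}}x^\rho)(\exists^{\mathrm{st}}y^\tau)\varphi(x,y)\to(\exists^{\mathrm{st}}F^{\rho\to\tau^*})(\forall^{\mathrm{st}}x^\rho)(\exists y^\tau\in F(x))\varphi(x,y)$.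 A real number is a sequence $(q_n)$ of (coded) rationals with $|q_n-q_{n+i}|<2^{-n}$ for all $n,i$; every function of type $1=0\to0$ is read as a real number by keeping its values as long as this condition holds and freezing it at the last good value from then on. For real numbers, $x\approx y$ means $|x-y|\le 2^{-k}$ for all standard $k$. For $f$ of type $1$ and a sequence of real numbers $c$ of type $0\to1$, put $$\Pi^0_1\text{-}\mathsf{TRANS}(f):\quad (\forall^{\mathrm{st}}n)\,f(n)\neq0\ \to\ (\forall m)\,f(m)\neq0,$$ $$\mathsf{MCT}_{\mathsf{ns}}(c):\quad (\forall n)(c_n\le c_{n+1}\le1)\ \to\ (\forall N,M)\big(\neg\mathrm{st}(N)\wedge\neg\mathrm{st}(M)\to c_M\approx c_N\big).$$ **Theorem.** There are closed terms $s$ of type $(0\to1)\to(0\to1)$ and $t$ of type $1\to1$ of $\mathsf{E\text{-}PA}^{\omega*}$ such that $\mathsf{P}$ proves $$(\forall^{\mathrm{st}}f^1)\big[\mathsf{MCT}_{\mathsf{ns}}(t(f))\to\Pi^0_1\text{-}\mathsf{TRANS}(f)\big]$$ and $$(\forall^{\mathrm{st}}c^{0\to1})\big[(\forall^{\mathrm{st}}n^0)\,\Pi^0_1\text{-}\mathsf{TRANS}(s(c,n))\to\mathsf{MCT}_{\mathsf{ns}}(c)\big].$$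 Here $t$ is the term for which $t(f)(k)$ is the rational number $0$ if $f(i)\neq0$ for all $i\le k$, and $\sum_{i=1}^k 2^{-i}$ otherwise; $t(f)$ is read as a sequence of real numbers through the constant sequences. -/

import Mathlib

namespace SysP

/-! ## Finite types and typed terms -/

/-- The finite types: `0`, function types, and types `σ*` of finite sequences. -/
inductive Ty : Type
  | nat : Ty
  | arr : Ty → Ty → Ty
  | seq : Ty → Ty

infixr:60 " ⇒ " => Ty.arr

/-- Type `0`. -/
abbrev ty0 : Ty := Ty.nat

/-- Type `1`, i.e. `0 → 0`. -/
abbrev ty1 : Ty := ty0 ⇒ ty0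

/-- A context lists the types of the free variables, the most recently bound one first. -/
abbrev Ctx : Type := List Ty

/-- Typed de Bruijn variables. -/
inductive Var : Ctx → Ty → Type
  | vz {Γ : Ctx} {σ : Ty} : Var (σ :: Γ) σ
  | vs {Γ : Ctx} {σ τ : Ty} : Var Γ σ → Var (τ :: Γ) σ

/-- The terms of arithmetic in all finite types with finite sequences: simply typed lambda terms
over zero, successor, the recursors, the empty sequence, prefixing, and the list recursors. -/
inductive Tm : Ctx → Ty → Type
  | var {Γ : Ctx} {σ : Ty} : Var Γ σ → Tm Γ σ
  | app {Γ : Ctx} {σ τ : Ty} : Tm Γ (σ ⇒ τ) → Tm Γ σ → Tm Γ τ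
  | lam {Γ : Ctx} {σ τ : Ty} : Tm (σ :: Γ) τ → Tm Γ (σ ⇒ τ)
  | zero {Γ : Ctx} : Tm Γ ty0
  | succ {Γ : Ctx} : Tm Γ (ty0 ⇒ ty0)
  | recN {Γ : Ctx} (ρ : Ty) : Tm Γ (ty0 ⇒ ρ ⇒ (ρ ⇒ ty0 ⇒ ρ) ⇒ ρ)
  | nil {Γ : Ctx} (σ : Ty) : Tm Γ (Ty.seq σ)
  | cons {Γ : Ctx} (σ : Ty) : Tm Γ (σ ⇒ Ty.seq σ ⇒ Ty.seq σ)
  | recL {Γ : Ctx} (σ ρ : Ty) : Tm Γ (Ty.seq σ ⇒ ρ ⇒ (ρ ⇒ σ ⇒ ρ) ⇒ ρ)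

infixl:100 " ⬝ " => Tm.app

/-- Closed terms. -/
abbrev CTm (σ : Ty) : Type := Tm [] σ

/-- Renamings. -/
abbrev Ren (Γ Δ : Ctx) : Type := ∀ σ : Ty, Var Γ σ → Var Δ σ

/-- Simultaneous substitutions. -/
abbrev Sub (Γ Δ : Ctx) : Type := ∀ σ : Ty, Var Γ σ → Tm Δ σ

/-- Push a renaming under a binder. -/
def Ren.lift {Γ Δ : Ctx} (r : Ren Γ Δ) (τ : Ty) : Ren (τ :: Γ) (τ :: Δ)
  | _, Var.vz => Var.vz
  | _, Var.vs x => Var.vs (r _ x)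

def Tm.rename {Γ Δ : Ctx} {σ : Ty} (r : Ren Γ Δ) : Tm Γ σ → Tm Δ σ
  | .var x => .var (r _ x)
  | .app f a => .app (f.rename r) (a.rename r)
  | .lam b => .lam (b.rename (r.lift _))
  | .zero => .zero
  | .succ => .succ
  | .recN ρ => .recN ρ
  | .nil σ => .nil σ
  | .cons σ => .cons σ
  | .recL σ ρ => .recL σ ρ

/-- The renaming that weakens by one new variable. -/
def Ren.shift {Γ : Ctx} (τ : Ty) : Ren Γ (τ :: Γ) := fun _ x => Var.vs x

/-- Weakening by one variable. -/
def Tm.wk {Γ : Ctx} {σ : Ty} (τ : Ty) (t : Tm Γ σ) : Tm (τ :: Γ) σ := t.rename (Ren.shift τ)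

/-- Push a substitution under a binder. -/
def Sub.lift {Γ Δ : Ctx} (s : Sub Γ Δ) (τ : Ty) : Sub (τ :: Γ) (τ :: Δ)
  | _, Var.vz => .var Var.vz
  | _, Var.vs x => (s _ x).wk τ

def Tm.subst {Γ Δ : Ctx} {σ : Ty} (s : Sub Γ Δ) : Tm Γ σ → Tm Δ σ
  | .var x => s _ x
  | .app f a => .app (f.subst s) (a.subst s)
  | .lam b => .lam (b.subst (s.lift _))
  | .zero => .zero
  | .succ => .succ
  | .recN ρ => .recN ρ
  | .nil σ => .nil σ
  | .cons σ => .cons σ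
  | .recL σ ρ => .recL σ ρ

/-- The substitution of `a` for the variable bound last. -/
def Sub.one {Γ : Ctx} {τ : Ty} (a : Tm Γ τ) : Sub (τ :: Γ) Γ
  | _, Var.vz => a
  | _, Var.vs x => .var x

/-- The substitution of `n + 1` for the variable `n` bound last. -/
def Sub.next {Γ : Ctx} : Sub (ty0 :: Γ) (ty0 :: Γ)
  | _, Var.vz => Tm.succ ⬝ Tm.var Var.vz
  | _, Var.vs x => .var (Var.vs x)

/-- The renaming out of the empty context. -/
def Ren.empty {Γ : Ctx} : Ren [] Γ := fun _ x => by cases x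

/-- A closed term, read in an arbitrary context. -/
def Tm.closed {Γ : Ctx} {σ : Ty} (t : CTm σ) : Tm Γ σ := t.rename Ren.empty

abbrev v0 {Γ : Ctx} {σ : Ty} : Tm (σ :: Γ) σ := .var .vz
abbrev v1 {Γ : Ctx} {σ τ : Ty} : Tm (τ :: σ :: Γ) σ := .var (.vs .vz)
abbrev v2 {Γ : Ctx} {σ τ υ : Ty} : Tm (υ :: τ :: σ :: Γ) σ := .var (.vs (.vs .vz))
abbrev v3 {Γ : Ctx} {σ τ υ φ : Ty} : Tm (φ :: υ :: τ :: σ :: Γ) σ := .var (.vs (.vs (.vs .vz)))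

/-! ## Formulas -/

/-- Formulas of the language with the standardness predicates; equality is primitive at every
type. -/
inductive Fm : Ctx → Type
  | eq {Γ : Ctx} {σ : Ty} : Tm Γ σ → Tm Γ σ → Fm Γ
  | st {Γ : Ctx} {σ : Ty} : Tm Γ σ → Fm Γ
  | bot {Γ : Ctx} : Fm Γ
  | conj {Γ : Ctx} : Fm Γ → Fm Γ → Fm Γ
  | disj {Γ : Ctx} : Fm Γ → Fm Γ → Fm Γ
  | imp {Γ : Ctx} : Fm Γ → Fm Γ → Fm Γ
  | all {Γ : Ctx} (σ : Ty) : Fm (σ :: Γ) → Fm Γ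
  | ex {Γ : Ctx} (σ : Ty) : Fm (σ :: Γ) → Fm Γ

/-- Internal formulas: those without standardness predicates. -/
def Fm.Internal : {Γ : Ctx} → Fm Γ → Prop
  | _, .eq _ _ => True
  | _, .st _ => False
  | _, .bot => True
  | _, .conj φ ψ => φ.Internal ∧ ψ.Internal
  | _, .disj φ ψ => φ.Internal ∧ ψ.Internal
  | _, .imp φ ψ => φ.Internal ∧ ψ.Internal
  | _, .all _ φ => φ.Internal
  | _, .ex _ φ => φ.Internal

def Fm.rename {Γ Δ : Ctx} (r : Ren Γ Δ) : Fm Γ → Fm Δ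
  | .eq a b => .eq (a.rename r) (b.rename r)
  | .st a => .st (a.rename r)
  | .bot => .bot
  | .conj φ ψ => .conj (φ.rename r) (ψ.rename r)
  | .disj φ ψ => .disj (φ.rename r) (ψ.rename r)
  | .imp φ ψ => .imp (φ.rename r) (ψ.rename r)
  | .all σ φ => .all σ (φ.rename (r.lift σ))
  | .ex σ φ => .ex σ (φ.rename (r.lift σ))

def Fm.subst {Γ Δ : Ctx} (s : Sub Γ Δ) : Fm Γ → Fm Δ
  | .eq a b => .eq (a.subst s) (b.subst s)
  | .st a => .st (a.subst s)
  | .bot => .bot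
  | .conj φ ψ => .conj (φ.subst s) (ψ.subst s)
  | .disj φ ψ => .disj (φ.subst s) (ψ.subst s)
  | .imp φ ψ => .imp (φ.subst s) (ψ.subst s)
  | .all σ φ => .all σ (φ.subst (s.lift σ))
  | .ex σ φ => .ex σ (φ.subst (s.lift σ))

def Fm.wk {Γ : Ctx} (τ : Ty) (φ : Fm Γ) : Fm (τ :: Γ) := φ.rename (Ren.shift τ)

/-- `φ(a)`, for `φ` with a distinguished last variable. -/
def Fm.inst {Γ : Ctx} {τ : Ty} (φ : Fm (τ :: Γ)) (a : Tm Γ τ) : Fm Γ := φ.subst (Sub.one a)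

/-- Weakening by a variable that sits below the last two ones. -/
def Fm.wkBelow {Γ : Ctx} {σ τ : Ty} (υ : Ty) (φ : Fm (σ :: τ :: Γ)) : Fm (σ :: τ :: υ :: Γ) :=
  φ.rename (((Ren.shift υ).lift τ).lift σ)

abbrev Fm.neg {Γ : Ctx} (φ : Fm Γ) : Fm Γ := φ.imp .bot

/-- The standard universal quantifier. -/
abbrev Fm.allSt {Γ : Ctx} (σ : Ty) (φ : Fm (σ :: Γ)) : Fm Γ := .all σ (.imp (.st v0) φ)

/-- The standard existential quantifier. -/
abbrev Fm.exSt {Γ : Ctx} (σ : Ty) (φ : Fm (σ :: Γ)) : Fm Γ := .ex σ (.conj (.st v0) φ)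

/-! ## Some primitive recursive closed terms

A characteristic function takes the value zero for "true". -/

/-- Definition by cases: `p, x, y ↦ x` if `p = 0`, and `y` otherwise. -/
def ifT {Γ : Ctx} (σ : Ty) : Tm Γ (ty0 ⇒ σ ⇒ σ ⇒ σ) :=
  .lam (.lam (.lam (.recN σ ⬝ v2 ⬝ v1 ⬝ .lam (.lam v2))))

def predT {Γ : Ctx} : Tm Γ (ty0 ⇒ ty0) :=
  .lam (.recN ty0 ⬝ v0 ⬝ .zero ⬝ .lam (.lam v0))

def addT {Γ : Ctx} : Tm Γ (ty0 ⇒ ty0 ⇒ ty0) :=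
  .lam (.lam (.recN ty0 ⬝ v0 ⬝ v1 ⬝ .lam (.lam (.succ ⬝ v1))))

/-- Truncated subtraction. -/
def subT {Γ : Ctx} : Tm Γ (ty0 ⇒ ty0 ⇒ ty0) :=
  .lam (.lam (.recN ty0 ⬝ v0 ⬝ v1 ⬝ .lam (.lam (predT ⬝ v1))))

def mulT {Γ : Ctx} : Tm Γ (ty0 ⇒ ty0 ⇒ ty0) :=
  .lam (.lam (.recN ty0 ⬝ v0 ⬝ .zero ⬝ .lam (.lam (addT ⬝ v1 ⬝ v3))))

/-- `n ↦ 2 ^ n`. -/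
def pow2T {Γ : Ctx} : Tm Γ (ty0 ⇒ ty0) :=
  .lam (.recN ty0 ⬝ v0 ⬝ (.succ ⬝ .zero) ⬝ .lam (.lam (addT ⬝ v1 ⬝ v1)))

/-- `k, p ↦ p 0 + ... + p k`, which is zero iff `p i = 0` for all `i ≤ k`. -/
def ballT {Γ : Ctx} : Tm Γ (ty0 ⇒ ty1 ⇒ ty0) :=
  .lam (.lam (.recN ty0 ⬝ v1 ⬝ (v0 ⬝ .zero) ⬝ .lam (.lam (addT ⬝ v1 ⬝ (v2 ⬝ (.succ ⬝ v0))))))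

/-- `n ↦ 0 + 1 + ... + n`. -/
def triT {Γ : Ctx} : Tm Γ (ty0 ⇒ ty0) :=
  .lam (.recN ty0 ⬝ v0 ⬝ .zero ⬝ .lam (.lam (addT ⬝ v1 ⬝ (.succ ⬝ v0))))

/-- The Cantor pairing `x, y ↦ (0 + 1 + ... + (x + y)) + y`. -/
def pairT {Γ : Ctx} : Tm Γ (ty0 ⇒ ty0 ⇒ ty0) :=
  .lam (.lam (addT ⬝ (triT ⬝ (addT ⬝ v1 ⬝ v0)) ⬝ v0))

/-- `z ↦` the largest `w` with `0 + 1 + ... + w ≤ z`. -/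
def diagT {Γ : Ctx} : Tm Γ (ty0 ⇒ ty0) :=
  .lam (.recN ty0 ⬝ v0 ⬝ .zero ⬝
    .lam (.lam (ifT ty0 ⬝ (subT ⬝ (triT ⬝ (.succ ⬝ v1)) ⬝ (.succ ⬝ v0)) ⬝ (.succ ⬝ v1) ⬝ v1)))

def sndT {Γ : Ctx} : Tm Γ (ty0 ⇒ ty0) := .lam (subT ⬝ v0 ⬝ (triT ⬝ (diagT ⬝ v0)))

def fstT {Γ : Ctx} : Tm Γ (ty0 ⇒ ty0) := .lam (subT ⬝ (diagT ⬝ v0) ⬝ (sndT ⬝ v0))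

/-! ## Finite sequences -/

/-- A closed term of each type. -/
def zeroT {Γ : Ctx} : (σ : Ty) → Tm Γ σ
  | .nat => .zero
  | .arr _ τ => .lam (zeroT τ)
  | .seq σ => .nil σ

/-- The length of a finite sequence. -/
def lenT {Γ : Ctx} (σ : Ty) : Tm Γ (Ty.seq σ ⇒ ty0) :=
  .lam (.recL σ ty0 ⬝ v0 ⬝ .zero ⬝ .lam (.lam (.succ ⬝ v1)))

/-- The entries of a finite sequence: the entry of `a, x` at `0` is `a`, the one at `i + 1` is the
entry of `x` at `i`. -/
def nthT {Γ : Ctx} (σ : Ty) : Tm Γ (Ty.seq σ ⇒ ty0 ⇒ σ) :=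
  .lam (.recL σ (ty0 ⇒ σ) ⬝ v0 ⬝ .lam (zeroT σ) ⬝
    .lam (.lam (.lam (.recN σ ⬝ v0 ⬝ v1 ⬝ .lam (.lam (.var (.vs (.vs (.vs (.vs .vz)))) ⬝ v0))))))

/-- `a ≤ b` for numbers. -/
def leF {Γ : Ctx} (a b : Tm Γ ty0) : Fm Γ := .eq (subT ⬝ a ⬝ b) .zero

/-- `a < b` for numbers. -/
def ltF {Γ : Ctx} (a b : Tm Γ ty0) : Fm Γ := leF (.succ ⬝ a) b

/-- `a ∈ x` for a finite sequence `x`: some `i < |x|` has `x(i) = a`. -/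
def memF {Γ : Ctx} {σ : Ty} (a : Tm Γ σ) (x : Tm Γ (Ty.seq σ)) : Fm Γ :=
  .ex ty0 (.conj (ltF v0 (lenT σ ⬝ x.wk ty0)) (.eq (nthT σ ⬝ x.wk ty0 ⬝ v0) (a.wk ty0)))

/-! ## The axioms and the deduction system -/

/-- The axioms of Peano arithmetic in all finite types with extensionality and types of finite
sequences. Parameters are allowed everywhere, as free variables. -/
inductive AxEPA : {Γ : Ctx} → Fm Γ → Prop
  | beta {Γ : Ctx} {σ τ : Ty} (b : Tm (σ :: Γ) τ) (a : Tm Γ σ) :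
      AxEPA (.eq (.lam b ⬝ a) (b.subst (Sub.one a)))
  | ext {Γ : Ctx} {σ τ : Ty} (f g : Tm Γ (σ ⇒ τ)) :
      AxEPA (.imp (.all σ (.eq (f.wk σ ⬝ v0) (g.wk σ ⬝ v0))) (.eq f g))
  | succ_ne_zero {Γ : Ctx} (a : Tm Γ ty0) : AxEPA (Fm.neg (.eq (.succ ⬝ a) .zero))
  | succ_inj {Γ : Ctx} (a b : Tm Γ ty0) :
      AxEPA (.imp (.eq (.succ ⬝ a) (.succ ⬝ b)) (.eq a b))
  | recN_zero {Γ : Ctx} {ρ : Ty} (y : Tm Γ ρ) (z : Tm Γ (ρ ⇒ ty0 ⇒ ρ)) :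
      AxEPA (.eq (.recN ρ ⬝ .zero ⬝ y ⬝ z) y)
  | recN_succ {Γ : Ctx} {ρ : Ty} (n : Tm Γ ty0) (y : Tm Γ ρ) (z : Tm Γ (ρ ⇒ ty0 ⇒ ρ)) :
      AxEPA (.eq (.recN ρ ⬝ (.succ ⬝ n) ⬝ y ⬝ z) (z ⬝ (.recN ρ ⬝ n ⬝ y ⬝ z) ⬝ n))
  | ind {Γ : Ctx} (φ : Fm (ty0 :: Γ)) (hφ : φ.Internal) :
      AxEPA (.imp (.conj (φ.inst .zero) (.all ty0 (.imp φ (φ.subst Sub.next)))) (.all ty0 φ))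
  | seq_cases {Γ : Ctx} {σ : Ty} (x : Tm Γ (Ty.seq σ)) :
      AxEPA (.disj (.eq x (.nil σ))
        (.ex σ (.ex (Ty.seq σ) (.eq ((x.wk σ).wk (Ty.seq σ)) (.cons σ ⬝ v1 ⬝ v0)))))
  | recL_nil {Γ : Ctx} {σ ρ : Ty} (y : Tm Γ ρ) (z : Tm Γ (ρ ⇒ σ ⇒ ρ)) :
      AxEPA (.eq (.recL σ ρ ⬝ .nil σ ⬝ y ⬝ z) y)
  | recL_cons {Γ : Ctx} {σ ρ : Ty} (a : Tm Γ σ) (x : Tm Γ (Ty.seq σ)) (y : Tm Γ ρ)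
      (z : Tm Γ (ρ ⇒ σ ⇒ ρ)) :
      AxEPA (.eq (.recL σ ρ ⬝ (.cons σ ⬝ a ⬝ x) ⬝ y ⬝ z) (z ⬝ (.recL σ ρ ⬝ x ⬝ y ⬝ z) ⬝ a))

/-- The axioms of the system `P`: those above, the standardness axioms, external induction,
idealisation, and the herbrandised axiom of choice for internal formulas. -/
inductive AxP : {Γ : Ctx} → Fm Γ → Prop
  | epa {Γ : Ctx} {φ : Fm Γ} : AxEPA φ → AxP φ
  | st_eq {Γ : Ctx} {σ : Ty} (a b : Tm Γ σ) :
      AxP (.imp (.conj (.st a) (.eq a b)) (.st b))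
  | st_closed {Γ : Ctx} {σ : Ty} (t : CTm σ) : AxP (Fm.st (t.closed : Tm Γ σ))
  | st_app {Γ : Ctx} {σ τ : Ty} (f : Tm Γ (σ ⇒ τ)) (a : Tm Γ σ) :
      AxP (.imp (.conj (.st f) (.st a)) (.st (f ⬝ a)))
  | ind_st {Γ : Ctx} (φ : Fm (ty0 :: Γ)) :
      AxP (.imp (.conj (φ.inst .zero) (.allSt ty0 (.imp φ (φ.subst Sub.next)))) (.allSt ty0 φ))
  | hac {Γ : Ctx} {ρ τ : Ty} (φ : Fm (τ :: ρ :: Γ)) (hφ : φ.Internal) :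
      AxP (.imp (.allSt ρ (.exSt τ φ))
        (.exSt (ρ ⇒ Ty.seq τ) (.allSt ρ (.ex τ (.conj (memF v0 (v2 ⬝ v1)) (φ.wkBelow _))))))
  | idealisation {Γ : Ctx} {σ τ : Ty} (φ : Fm (σ :: τ :: Γ)) (hφ : φ.Internal) :
      AxP (.imp (.allSt (Ty.seq σ) (.ex τ (.all σ (.imp (memF v0 v2) (φ.wkBelow _)))))
        (.ex τ (.allSt σ φ)))

/-- Classical natural deduction with equality over the axioms of `P`: `Prf H φ` says that `φ` is
derivable from the hypotheses `H`, all with free variables in the context `Γ`. -/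
inductive Prf : {Γ : Ctx} → List (Fm Γ) → Fm Γ → Prop
  | ax {Γ : Ctx} {H : List (Fm Γ)} {φ : Fm Γ} : AxP φ → Prf H φ
  | hyp {Γ : Ctx} {H : List (Fm Γ)} {φ : Fm Γ} : φ ∈ H → Prf H φ
  | raa {Γ : Ctx} {H : List (Fm Γ)} {φ : Fm Γ} : Prf (φ.neg :: H) .bot → Prf H φ
  | conjI {Γ : Ctx} {H : List (Fm Γ)} {φ ψ : Fm Γ} : Prf H φ → Prf H ψ → Prf H (.conj φ ψ)
  | conjE1 {Γ : Ctx} {H : List (Fm Γ)} {φ ψ : Fm Γ} : Prf H (.conj φ ψ) → Prf H φ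
  | conjE2 {Γ : Ctx} {H : List (Fm Γ)} {φ ψ : Fm Γ} : Prf H (.conj φ ψ) → Prf H ψ
  | disjI1 {Γ : Ctx} {H : List (Fm Γ)} {φ ψ : Fm Γ} : Prf H φ → Prf H (.disj φ ψ)
  | disjI2 {Γ : Ctx} {H : List (Fm Γ)} {φ ψ : Fm Γ} : Prf H ψ → Prf H (.disj φ ψ)
  | disjE {Γ : Ctx} {H : List (Fm Γ)} {φ ψ χ : Fm Γ} :
      Prf H (.disj φ ψ) → Prf (φ :: H) χ → Prf (ψ :: H) χ → Prf H χ
  | impI {Γ : Ctx} {H : List (Fm Γ)} {φ ψ : Fm Γ} : Prf (φ :: H) ψ → Prf H (.imp φ ψ)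
  | impE {Γ : Ctx} {H : List (Fm Γ)} {φ ψ : Fm Γ} : Prf H (.imp φ ψ) → Prf H φ → Prf H ψ
  | allI {Γ : Ctx} {H : List (Fm Γ)} {σ : Ty} {φ : Fm (σ :: Γ)} :
      Prf (H.map (Fm.wk σ)) φ → Prf H (.all σ φ)
  | allE {Γ : Ctx} {H : List (Fm Γ)} {σ : Ty} {φ : Fm (σ :: Γ)} (a : Tm Γ σ) :
      Prf H (.all σ φ) → Prf H (φ.inst a)
  | exI {Γ : Ctx} {H : List (Fm Γ)} {σ : Ty} {φ : Fm (σ :: Γ)} (a : Tm Γ σ) :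
      Prf H (φ.inst a) → Prf H (.ex σ φ)
  | exE {Γ : Ctx} {H : List (Fm Γ)} {σ : Ty} {φ : Fm (σ :: Γ)} {χ : Fm Γ} :
      Prf H (.ex σ φ) → Prf (φ :: H.map (Fm.wk σ)) (χ.wk σ) → Prf H χ
  | eq_refl {Γ : Ctx} {H : List (Fm Γ)} {σ : Ty} (a : Tm Γ σ) : Prf H (.eq a a)
  | eq_subst {Γ : Ctx} {H : List (Fm Γ)} {σ : Ty} (φ : Fm (σ :: Γ)) {a b : Tm Γ σ} :
      Prf H (.eq a b) → Prf H (φ.inst a) → Prf H (φ.inst b)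

/-- The system `P` proves the sentence `φ`. -/
def ProvesP (φ : Fm []) : Prop := Prf [] φ

/-! ## Rational numbers

The number `q = ((p, m), d)`, where the pairs are Cantor pairs, is a code of the rational number
`(p - m) / (d + 1)`. Every number is a code, and every rational number has one. -/

/-- The positive part `p` of the numerator. -/
def numPT {Γ : Ctx} : Tm Γ (ty0 ⇒ ty0) := .lam (fstT ⬝ (fstT ⬝ v0))

/-- The negative part `m` of the numerator. -/
def numMT {Γ : Ctx} : Tm Γ (ty0 ⇒ ty0) := .lam (sndT ⬝ (fstT ⬝ v0))

/-- The denominator `d + 1`. -/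
def denT {Γ : Ctx} : Tm Γ (ty0 ⇒ ty0) := .lam (.succ ⬝ (sndT ⬝ v0))

/-- `p, m, e ↦` a code of `(p - m) / e`, for positive `e`. -/
def mkQT {Γ : Ctx} : Tm Γ (ty0 ⇒ ty0 ⇒ ty0 ⇒ ty0) :=
  .lam (.lam (.lam (pairT ⬝ (pairT ⬝ v2 ⬝ v1) ⬝ (predT ⬝ v0))))

def zeroQT {Γ : Ctx} : Tm Γ ty0 := mkQT ⬝ .zero ⬝ .zero ⬝ (.succ ⬝ .zero)

def oneQT {Γ : Ctx} : Tm Γ ty0 := mkQT ⬝ (.succ ⬝ .zero) ⬝ .zero ⬝ (.succ ⬝ .zero)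

/-- `n ↦ 1 / 2 ^ n`. -/
def invPow2QT {Γ : Ctx} : Tm Γ (ty0 ⇒ ty0) :=
  .lam (mkQT ⬝ (.succ ⬝ .zero) ⬝ .zero ⬝ (pow2T ⬝ v0))

def addQT {Γ : Ctx} : Tm Γ (ty0 ⇒ ty0 ⇒ ty0) :=
  .lam (.lam (mkQT ⬝
    (addT ⬝ (mulT ⬝ (numPT ⬝ v1) ⬝ (denT ⬝ v0)) ⬝ (mulT ⬝ (numPT ⬝ v0) ⬝ (denT ⬝ v1))) ⬝
    (addT ⬝ (mulT ⬝ (numMT ⬝ v1) ⬝ (denT ⬝ v0)) ⬝ (mulT ⬝ (numMT ⬝ v0) ⬝ (denT ⬝ v1))) ⬝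
    (mulT ⬝ (denT ⬝ v1) ⬝ (denT ⬝ v0))))

def negQT {Γ : Ctx} : Tm Γ (ty0 ⇒ ty0) :=
  .lam (mkQT ⬝ (numMT ⬝ v0) ⬝ (numPT ⬝ v0) ⬝ (denT ⬝ v0))

def absQT {Γ : Ctx} : Tm Γ (ty0 ⇒ ty0) :=
  .lam (ifT ty0 ⬝ (subT ⬝ (numMT ⬝ v0) ⬝ (numPT ⬝ v0)) ⬝ v0 ⬝ (negQT ⬝ v0))

/-- `q, r ↦ |q - r|`. -/
def distQT {Γ : Ctx} : Tm Γ (ty0 ⇒ ty0 ⇒ ty0) :=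
  .lam (.lam (absQT ⬝ (addQT ⬝ v1 ⬝ (negQT ⬝ v0))))

/-- The left-hand side of `q ≤ r` after clearing denominators and negative parts; the right-hand
side is the same with `q` and `r` exchanged. -/
def crossT {Γ : Ctx} : Tm Γ (ty0 ⇒ ty0 ⇒ ty0) :=
  .lam (.lam (addT ⬝ (mulT ⬝ (numPT ⬝ v1) ⬝ (denT ⬝ v0)) ⬝ (mulT ⬝ (numMT ⬝ v0) ⬝ (denT ⬝ v1))))

/-- The characteristic function of `q ≤ r`. -/
def leQT {Γ : Ctx} : Tm Γ (ty0 ⇒ ty0 ⇒ ty0) :=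
  .lam (.lam (subT ⬝ (crossT ⬝ v1 ⬝ v0) ⬝ (crossT ⬝ v0 ⬝ v1)))

/-- The characteristic function of `q < r`. -/
def ltQT {Γ : Ctx} : Tm Γ (ty0 ⇒ ty0 ⇒ ty0) :=
  .lam (.lam (subT ⬝ (.succ ⬝ (crossT ⬝ v1 ⬝ v0)) ⬝ (crossT ⬝ v0 ⬝ v1)))

/-- `q ≤ r` for rational numbers. -/
def leQF {Γ : Ctx} (q r : Tm Γ ty0) : Fm Γ := .eq (leQT ⬝ q ⬝ r) .zero

/-! ## Real numbers

A real number is a sequence `q` of rational numbers with `|q a - q b| < 1 / 2 ^ a` for `a ≤ b`. -/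

/-- The characteristic function, in `q` and `n`, of: `|q a - q b| < 1 / 2 ^ a` for all
`a ≤ b ≤ n`. -/
def goodT {Γ : Ctx} : Tm Γ (ty1 ⇒ ty0 ⇒ ty0) :=
  .lam (.lam (ballT ⬝ v0 ⬝ .lam (ballT ⬝ v0 ⬝
    .lam (ltQT ⬝ (distQT ⬝ (v3 ⬝ v0) ⬝ (v3 ⬝ v1)) ⬝ (invPow2QT ⬝ v0)))))

/-- The hat function: `q` itself as long as it converges fast enough, and the last good value from
then on. It makes a real number of every sequence, and leaves real numbers unchanged. -/
def hatT {Γ : Ctx} : Tm Γ (ty1 ⇒ ty1) :=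
  .lam (.lam (.recN ty0 ⬝ v0 ⬝ (v1 ⬝ .zero) ⬝
    .lam (.lam (ifT ty0 ⬝ (goodT ⬝ v3 ⬝ (.succ ⬝ v0)) ⬝ (v3 ⬝ (.succ ⬝ v0)) ⬝ v1))))

/-- A rational number as a real number. -/
def ratRT {Γ : Ctx} : Tm Γ (ty0 ⇒ ty1) := .lam (.lam v1)

/-- A sequence of rational numbers as a sequence of real numbers. -/
def ratSeqT {Γ : Ctx} : Tm Γ (ty1 ⇒ (ty0 ⇒ ty1)) := .lam (.lam (ratRT ⬝ (v1 ⬝ v0)))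

/-- `x ≤ y` for real numbers: `[x](n) ≤ [y](n) + 2 / 2 ^ n` for all `n`. -/
def leRF {Γ : Ctx} (x y : Tm Γ ty1) : Fm Γ :=
  .all ty0 (leQF (hatT ⬝ x.wk ty0 ⬝ v0)
    (addQT ⬝ (hatT ⬝ y.wk ty0 ⬝ v0) ⬝ (addQT ⬝ (invPow2QT ⬝ v0) ⬝ (invPow2QT ⬝ v0))))

/-- `|x - y| ≤ 1 / 2 ^ k` for real numbers: `|[x](n) - [y](n)| ≤ 1 / 2 ^ k + 2 / 2 ^ n` for
all `n`. -/
def distLeRF {Γ : Ctx} (x y : Tm Γ ty1) (k : Tm Γ ty0) : Fm Γ :=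
  .all ty0 (leQF (distQT ⬝ (hatT ⬝ x.wk ty0 ⬝ v0) ⬝ (hatT ⬝ y.wk ty0 ⬝ v0))
    (addQT ⬝ (invPow2QT ⬝ k.wk ty0) ⬝ (addQT ⬝ (invPow2QT ⬝ v0) ⬝ (invPow2QT ⬝ v0))))

/-- `x ≈ y` for real numbers: `|x - y| ≤ 1 / 2 ^ k` for all standard `k`. -/
def nearF {Γ : Ctx} (x y : Tm Γ ty1) : Fm Γ :=
  .allSt ty0 (distLeRF (x.wk ty0) (y.wk ty0) v0)

/-! ## The two principles and the terms -/

/-- Transfer for the function `f`: if `f n ≠ 0` for all standard `n`, then `f m ≠ 0` for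
all `m`. -/
def transF {Γ : Ctx} (f : Tm Γ ty1) : Fm Γ :=
  .imp (.allSt ty0 (Fm.neg (.eq (f.wk ty0 ⬝ v0) .zero)))
    (.all ty0 (Fm.neg (.eq (f.wk ty0 ⬝ v0) .zero)))

/-- Nonstandard monotone convergence for the sequence `c` of real numbers: if
`c n ≤ c (n + 1) ≤ 1` for all `n`, then `c M ≈ c N` for all nonstandard `N` and `M`. -/
def mctF {Γ : Ctx} (c : Tm Γ (ty0 ⇒ ty1)) : Fm Γ :=
  .imp
    (.all ty0 (.conj (leRF (c.wk ty0 ⬝ v0) (c.wk ty0 ⬝ (.succ ⬝ v0)))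
      (leRF (c.wk ty0 ⬝ (.succ ⬝ v0)) (ratRT ⬝ oneQT))))
    (.all ty0 (.all ty0 (.imp (.conj (Fm.neg (.st v1)) (Fm.neg (.st v0)))
      (nearF ((c.wk ty0).wk ty0 ⬝ v0) ((c.wk ty0).wk ty0 ⬝ v1)))))

/-- `k ↦ 1 / 2 ^ 1 + ... + 1 / 2 ^ k`. -/
def geomT {Γ : Ctx} : Tm Γ ty1 :=
  .lam (.recN ty0 ⬝ v0 ⬝ zeroQT ⬝ .lam (.lam (addQT ⬝ v1 ⬝ (invPow2QT ⬝ (.succ ⬝ v0)))))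

/-- The term `t`: `t f k` is `0` if `f i ≠ 0` for all `i ≤ k`, and `1 / 2 ^ 1 + ... + 1 / 2 ^ k`
otherwise. -/
def tT {Γ : Ctx} : Tm Γ (ty1 ⇒ ty1) :=
  .lam (.lam (ifT ty0 ⬝ (ballT ⬝ v0 ⬝ .lam (subT ⬝ (.succ ⬝ .zero) ⬝ (v2 ⬝ v0))) ⬝
    zeroQT ⬝ (geomT ⬝ v0)))

/-- For all standard `f`: monotone convergence for `t f` implies transfer for `f`. -/
def mctToTrans (t : CTm (ty1 ⇒ ty1)) : Fm [] :=
  .allSt ty1 (.imp (mctF (ratSeqT ⬝ (t.closed ⬝ v0))) (transF v0))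

/-- For all standard sequences `c` of real numbers: transfer for `s c n`, for all standard `n`,
implies monotone convergence for `c`. -/
def transToMct (s : CTm ((ty0 ⇒ ty1) ⇒ ty0 ⇒ ty1)) : Fm [] :=
  .allSt (ty0 ⇒ ty1) (.imp (.allSt ty0 (transF (s.closed ⬝ v1 ⬝ v0))) (mctF v0))

end SysP

namespace SysP

variable {Γ Δ Θ : Ctx} {σ τ : Ty}

/-! ## The calculus of renamings and substitutions -/

/-! No derivation in `P` is written down beyond small ones. By Henkin's completeness argument
(`provesP_of_sat`), a sentence that holds in every structure of type `Model` is derivable, and both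
sentences are then checked by ordinary mathematics in an arbitrary model. A `Model` records only
arithmetic with extensionality, internal induction, the closure properties of standardness and
external induction. Idealisation, choice and the axioms for finite sequences play no role.

Inside a model the numbers form an ordered semiring `M.N`, in general with nonstandard elements. Its
field of fractions `M.K` is an ordered field, and `M.rv` sends a code to its value there, so that
estimates on coded rationals become linear arithmetic over `M.K`.

From convergence to transfer (`trans_of_mct`): suppose `f` has no standard zero but has some zero.
Internal induction gives a least zero `l`, which is nonstandard, hence `l = n + 1` with `n`
nonstandard. The sequence `t f` is nondecreasing and at most 1, vanishes at `n`, and equals `1 -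
2^(-l)` at `l`. So it jumps by almost 1 between two nonstandard indices.

From transfer to convergence (`mct_of_trans`): the term `s c (q, p)` has a zero at `n` exactly when
the `p`-th approximation of `c n` exceeds the rational `q`. For standard `q` and `p`, transfer then
says that a threshold exceeded anywhere is exceeded at a standard index (`exists_st_of_lt`). If `c
b` exceeds `c a` by more than `2^(-k)`, with `a` nonstandard and `k` standard, fix a standard
precision `p = k + 3` and a grid of mesh `2^(-p)` starting below `c 0`. Whenever a grid point is not
above `c a` (up to a small error), the next one is still below `c b`, hence below some `c i` with
`i` standard, hence below `c a` up to the same error, by monotonicity and `i < a`. External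
induction carries this through all standard grid points, which go past 1, against the bound on `c`.
-/

/-- Extend a substitution by a term for the new variable. -/
def Sub.cons (a : Tm Δ τ) (s : Sub Γ Δ) : Sub (τ :: Γ) Δ
  | _, Var.vz => a
  | _, Var.vs x => s _ x

theorem Ren.lift_comp (r : Ren Γ Δ) (r' : Ren Δ Θ) (τ : Ty) :
    (fun σ x => r'.lift τ σ (r.lift τ σ x)) = Ren.lift (fun σ x => r' σ (r σ x)) τ := by
  funext σ x; cases x <;> rfl

theorem Sub.lift_comp_ren (r : Ren Γ Δ) (s : Sub Δ Θ) (τ : Ty) :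
    (fun σ x => s.lift τ σ (r.lift τ σ x)) = Sub.lift (fun σ x => s σ (r σ x)) τ := by
  funext σ x; cases x <;> rfl

theorem Sub.lift_var (τ : Ty) :
    Sub.lift (fun _ x => Tm.var x : Sub Γ Γ) τ = fun _ x => Tm.var x := by
  funext σ x; cases x <;> rfl

/-- The four composition laws come in a forced order: lifting a substitution under a binder weakens
its values, so each law involving substitutions needs the earlier ones for renamings. -/
theorem Tm.rename_rename (t : Tm Γ σ) : ∀ {Δ Θ : Ctx} (r : Ren Γ Δ) (r' : Ren Δ Θ),
    (t.rename r).rename r' = t.rename (fun σ x => r' σ (r σ x)) := by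
  induction t <;> intro Δ Θ r r' <;> simp_all [Tm.rename, Ren.lift_comp]

theorem Tm.subst_rename (t : Tm Γ σ) : ∀ {Δ Θ : Ctx} (r : Ren Γ Δ) (s : Sub Δ Θ),
    (t.rename r).subst s = t.subst (fun σ x => s σ (r σ x)) := by
  induction t <;> intro Δ Θ r s <;> simp_all [Tm.rename, Tm.subst, Sub.lift_comp_ren]

theorem Sub.lift_rename (s : Sub Γ Δ) (r : Ren Δ Θ) (τ : Ty) :
    (fun σ x => (s.lift τ σ x).rename (r.lift τ)) = Sub.lift (fun σ x => (s σ x).rename r) τ := by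
  funext σ x
  cases x
  · rfl
  · simp only [Sub.lift, Tm.wk, Tm.rename_rename]; rfl

theorem Tm.rename_subst (t : Tm Γ σ) : ∀ {Δ Θ : Ctx} (s : Sub Γ Δ) (r : Ren Δ Θ),
    (t.subst s).rename r = t.subst (fun σ x => (s σ x).rename r) := by
  induction t <;> intro Δ Θ s r <;> simp_all [Tm.rename, Tm.subst, Sub.lift_rename]

theorem Sub.lift_subst (s : Sub Γ Δ) (u : Sub Δ Θ) (τ : Ty) :
    (fun σ x => (s.lift τ σ x).subst (u.lift τ)) = Sub.lift (fun σ x => (s σ x).subst u) τ := by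
  funext σ x
  cases x
  · rfl
  · simp only [Sub.lift, Tm.wk, Tm.rename_subst, Tm.subst_rename]; rfl

theorem Tm.subst_subst (t : Tm Γ σ) : ∀ {Δ Θ : Ctx} (s : Sub Γ Δ) (u : Sub Δ Θ),
    (t.subst s).subst u = t.subst (fun σ x => (s σ x).subst u) := by
  induction t <;> intro Δ Θ s u <;> simp_all [Tm.subst, Sub.lift_subst]

theorem Tm.subst_var (t : Tm Γ σ) : t.subst (fun _ x => .var x) = t := by
  induction t <;> simp_all [Tm.subst, Sub.lift_var]

theorem Fm.subst_rename (φ : Fm Γ) : ∀ {Δ Θ : Ctx} (r : Ren Γ Δ) (s : Sub Δ Θ),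
    (φ.rename r).subst s = φ.subst (fun σ x => s σ (r σ x)) := by
  induction φ <;> intro Δ Θ r s <;>
    simp_all [Fm.rename, Fm.subst, Sub.lift_comp_ren, Tm.subst_rename]

theorem Fm.rename_subst (φ : Fm Γ) : ∀ {Δ Θ : Ctx} (s : Sub Γ Δ) (r : Ren Δ Θ),
    (φ.subst s).rename r = φ.subst (fun σ x => (s σ x).rename r) := by
  induction φ <;> intro Δ Θ s r <;>
    simp_all [Fm.rename, Fm.subst, Sub.lift_rename, Tm.rename_subst]

theorem Fm.subst_subst (φ : Fm Γ) : ∀ {Δ Θ : Ctx} (s : Sub Γ Δ) (u : Sub Δ Θ),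
    (φ.subst s).subst u = φ.subst (fun σ x => (s σ x).subst u) := by
  induction φ <;> intro Δ Θ s u <;> simp_all [Fm.subst, Sub.lift_subst, Tm.subst_subst]

theorem Fm.subst_var (φ : Fm Γ) : φ.subst (fun _ x => .var x) = φ := by
  induction φ <;> simp_all [Fm.subst, Sub.lift_var, Tm.subst_var]

theorem Sub.lift_one (s : Sub Γ Δ) (a : Tm Δ τ) :
    (fun σ x => (s.lift τ σ x).subst (Sub.one a)) = Sub.cons a s := by
  funext σ x
  cases x
  · rfl
  · simp only [Sub.lift, Tm.wk, Tm.subst_rename]; exact Tm.subst_var _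

theorem Tm.subst_lift_one (t : Tm (τ :: Γ) σ) (s : Sub Γ Δ) (a : Tm Δ τ) :
    (t.subst (s.lift τ)).subst (Sub.one a) = t.subst (Sub.cons a s) := by
  rw [Tm.subst_subst, Sub.lift_one]

theorem Fm.inst_subst_lift (φ : Fm (τ :: Γ)) (s : Sub Γ Δ) (a : Tm Δ τ) :
    (φ.subst (s.lift τ)).inst a = φ.subst (Sub.cons a s) := by
  rw [Fm.inst, Fm.subst_subst, Sub.lift_one]

theorem Sub.one_subst (a : Tm Γ τ) (s : Sub Γ Δ) :
    (fun σ x => (Sub.one a σ x).subst s) = Sub.cons (a.subst s) s := by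
  funext σ x; cases x <;> rfl

end SysP

namespace SysP

/-! ## Countability of the language -/

/-- Countability of types, terms and formulas is needed so that Henkin's construction can treat all
formulas in countably many stages. In each case the objects of bounded height are countable, by
induction on the bound. -/
instance : Countable Ty := by
  let d : Ty → ℕ := fun t => Ty.rec 0 (fun _ _ a b => max a b + 1) (fun _ a => a + 1) t
  have key : ∀ n, {t : Ty | d t < n}.Countable := by
    intro n
    induction n with
    | zero => simp
    | succ n ih =>
      refine (((Set.countable_singleton Ty.nat).union (ih.image2 ih Ty.arr)).union
        (ih.image Ty.seq)).mono ?_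
      rintro (_ | ⟨a, b⟩ | a) h
      · simp
      · have h' : max (d a) (d b) + 1 < n + 1 := h
        exact Or.inl (Or.inr ⟨a, show d a < n by omega, b, show d b < n by omega, rfl⟩)
      · have h' : d a + 1 < n + 1 := h
        exact Or.inr ⟨a, show d a < n by omega, rfl⟩
  have : (⋃ n, {t : Ty | d t < n}).Countable := Set.countable_iUnion key
  exact Set.countable_univ_iff.1 (this.mono fun t _ => Set.mem_iUnion.2 ⟨d t + 1, Nat.lt_succ_self _⟩)

instance (Γ : Ctx) (σ : Ty) : Countable (Var Γ σ) := by
  induction Γ with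
  | nil => exact ⟨⟨fun x => (nomatch x : ℕ), fun x => nomatch x⟩⟩
  | cons τ Γ _ =>
    refine Set.countable_univ_iff.1
      (((Set.countable_range (fun x : Var Γ σ => (Var.vs x : Var (τ :: Γ) σ))).union
        (Set.Subsingleton.countable (s := {x : Var (τ :: Γ) σ | ∀ y, x ≠ Var.vs y}) ?_)).mono ?_)
    · intro x hx y hy
      cases x with
      | vs x => exact absurd rfl (hx x)
      | vz =>
        cases y with
        | vs y => exact absurd rfl (hy y)
        | vz => rfl
    · intro x _
      by_cases h : ∃ y, Var.vs y = x
      · exact Or.inl h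
      · exact Or.inr fun y hy => h ⟨y, hy.symm⟩

/-- The height of a term. -/
def Tm.height {Γ : Ctx} {σ : Ty} : Tm Γ σ → ℕ
  | .app f a => max f.height a.height + 1
  | .lam b => b.height + 1
  | _ => 0

theorem Tm.countable_height (n : ℕ) :
    ∀ (Γ : Ctx) (σ : Ty), {t : Tm Γ σ | t.height < n}.Countable := by
  induction n with
  | zero => simp
  | succ n ih =>
    intro Γ σ
    let A : Set (Tm Γ σ) := Set.range Tm.var
    let B : Set (Tm Γ σ) := ⋃ τ : Ty, Set.image2 (fun f a => Tm.app (σ := τ) f a)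
      {t | t.height < n} {t | t.height < n}
    let C : Set (Tm Γ σ) := {t | ∃ (a b : Ty) (h : (a ⇒ b) = σ), ∃ u ∈ {u : Tm (a :: Γ) b | u.height < n},
      t = h ▸ Tm.lam u}
    -- The constants: for given `a` and `b` each shape contributes at most one term of type `σ`,
    -- once the equation between the types is transported.
    let D : Set (Tm Γ σ) := {t | ∃ (a b : Ty),
      (∃ h : ty0 = σ, t = h ▸ Tm.zero) ∨ (∃ h : (ty0 ⇒ ty0) = σ, t = h ▸ Tm.succ) ∨
      (∃ h : (ty0 ⇒ a ⇒ (a ⇒ ty0 ⇒ a) ⇒ a) = σ, t = h ▸ Tm.recN a) ∨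
      (∃ h : Ty.seq a = σ, t = h ▸ Tm.nil a) ∨
      (∃ h : (a ⇒ Ty.seq a ⇒ Ty.seq a) = σ, t = h ▸ Tm.cons a) ∨
      (∃ h : (Ty.seq a ⇒ b ⇒ (b ⇒ a ⇒ b) ⇒ b) = σ, t = h ▸ Tm.recL a b)}
    have hA : A.Countable := Set.countable_range _
    have hB : B.Countable := Set.countable_iUnion fun τ => (ih _ _).image2 (ih _ _) _
    have hC : C.Countable := by
      have : C = ⋃ a : Ty, ⋃ b : Ty, ⋃ h : (a ⇒ b) = σ,
          (fun u => (h ▸ Tm.lam u : Tm Γ σ)) '' {u : Tm (a :: Γ) b | u.height < n} := by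
        ext t; simp [C, eq_comm]
      rw [this]
      exact Set.countable_iUnion fun a => Set.countable_iUnion fun b =>
        Set.countable_iUnion fun h => (ih _ _).image _
    have hD : D.Countable := by
      have : D = ⋃ a : Ty, ⋃ b : Ty, ({t | ∃ h : ty0 = σ, t = h ▸ Tm.zero} ∪
          ({t | ∃ h : (ty0 ⇒ ty0) = σ, t = h ▸ Tm.succ} ∪
          ({t | ∃ h : (ty0 ⇒ a ⇒ (a ⇒ ty0 ⇒ a) ⇒ a) = σ, t = h ▸ Tm.recN a} ∪
          ({t | ∃ h : Ty.seq a = σ, t = h ▸ Tm.nil a} ∪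
          ({t | ∃ h : (a ⇒ Ty.seq a ⇒ Ty.seq a) = σ, t = h ▸ Tm.cons a} ∪
          {t : Tm Γ σ | ∃ h : (Ty.seq a ⇒ b ⇒ (b ⇒ a ⇒ b) ⇒ b) = σ, t = h ▸ Tm.recL a b}))))) := by
        ext t; simp [D]
      rw [this]
      refine Set.countable_iUnion fun a => Set.countable_iUnion fun b => ?_
      refine .union ?_ (.union ?_ (.union ?_ (.union ?_ (.union ?_ ?_)))) <;>
      · refine Set.Subsingleton.countable ?_
        rintro x ⟨h, rfl⟩ y ⟨h', rfl⟩
        rfl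
    refine ((hA.union hB).union (hC.union hD)).mono ?_
    intro t ht
    cases t with
    | var x => exact Or.inl (Or.inl ⟨x, rfl⟩)
    | @app _ τ _ f a =>
      have h' : max f.height a.height + 1 < n + 1 := ht
      exact Or.inl (Or.inr (Set.mem_iUnion.2 ⟨τ, f, show f.height < n by omega, a,
        show a.height < n by omega, rfl⟩))
    | lam b =>
      have h' : b.height + 1 < n + 1 := ht
      exact Or.inr (Or.inl ⟨_, _, rfl, b, show b.height < n by omega, rfl⟩)
    | zero => exact Or.inr (Or.inr ⟨ty0, ty0, .inl ⟨rfl, rfl⟩⟩)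
    | succ => exact Or.inr (Or.inr ⟨ty0, ty0, .inr (.inl ⟨rfl, rfl⟩)⟩)
    | recN a => exact Or.inr (Or.inr ⟨a, ty0, .inr (.inr (.inl ⟨rfl, rfl⟩))⟩)
    | nil a => exact Or.inr (Or.inr ⟨a, ty0, .inr (.inr (.inr (.inl ⟨rfl, rfl⟩)))⟩)
    | cons a => exact Or.inr (Or.inr ⟨a, ty0, .inr (.inr (.inr (.inr (.inl ⟨rfl, rfl⟩))))⟩)
    | recL a b => exact Or.inr (Or.inr ⟨a, b, .inr (.inr (.inr (.inr (.inr ⟨rfl, rfl⟩))))⟩)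

instance (Γ : Ctx) (σ : Ty) : Countable (Tm Γ σ) :=
  Set.countable_univ_iff.1 ((Set.countable_iUnion fun n => Tm.countable_height n Γ σ).mono
    fun t _ => Set.mem_iUnion.2 ⟨t.height + 1, Nat.lt_succ_self _⟩)

/-- The height of a formula. -/
def Fm.height {Γ : Ctx} : Fm Γ → ℕ
  | .conj φ ψ => max φ.height ψ.height + 1
  | .disj φ ψ => max φ.height ψ.height + 1
  | .imp φ ψ => max φ.height ψ.height + 1
  | .all _ φ => φ.height + 1
  | .ex _ φ => φ.height + 1
  | _ => 0

theorem Fm.countable_height (n : ℕ) : ∀ Γ : Ctx, {φ : Fm Γ | φ.height < n}.Countable := by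
  induction n with
  | zero => simp
  | succ n ih =>
    intro Γ
    refine (((((((Set.countable_iUnion fun σ : Ty =>
        Set.countable_range fun p : Tm Γ σ × Tm Γ σ => Fm.eq p.1 p.2).union
      (Set.countable_iUnion fun σ : Ty => Set.countable_range fun a : Tm Γ σ => Fm.st a)).union
      (Set.countable_singleton Fm.bot)).union
      ((ih Γ).image2 (ih Γ) Fm.conj)).union
      ((ih Γ).image2 (ih Γ) Fm.disj)).union
      ((ih Γ).image2 (ih Γ) Fm.imp)).union
      ((Set.countable_iUnion fun σ : Ty => (ih (σ :: Γ)).image (Fm.all σ)).union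
      (Set.countable_iUnion fun σ : Ty => (ih (σ :: Γ)).image (Fm.ex σ)))).mono ?_
    intro φ hφ
    cases φ with
    | @eq _ σ a b =>
      exact .inl (.inl (.inl (.inl (.inl (.inl (Set.mem_iUnion.2 ⟨σ, (a, b), rfl⟩))))))
    | @st _ σ a => exact .inl (.inl (.inl (.inl (.inl (.inr (Set.mem_iUnion.2 ⟨σ, a, rfl⟩))))))
    | bot => exact .inl (.inl (.inl (.inl (.inr rfl))))
    | conj φ ψ =>
      have h' : max φ.height ψ.height + 1 < n + 1 := hφ
      exact .inl (.inl (.inl (.inr ⟨φ, show φ.height < n by omega, ψ,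
        show ψ.height < n by omega, rfl⟩)))
    | disj φ ψ =>
      have h' : max φ.height ψ.height + 1 < n + 1 := hφ
      exact .inl (.inl (.inr ⟨φ, show φ.height < n by omega, ψ,
        show ψ.height < n by omega, rfl⟩))
    | imp φ ψ =>
      have h' : max φ.height ψ.height + 1 < n + 1 := hφ
      exact .inl (.inr ⟨φ, show φ.height < n by omega, ψ, show ψ.height < n by omega, rfl⟩)
    | all σ φ =>
      have h' : φ.height + 1 < n + 1 := hφ
      exact .inr (.inl (Set.mem_iUnion.2 ⟨σ, φ, show φ.height < n by omega, rfl⟩))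
    | ex σ φ =>
      have h' : φ.height + 1 < n + 1 := hφ
      exact .inr (.inr (Set.mem_iUnion.2 ⟨σ, φ, show φ.height < n by omega, rfl⟩))

instance (Γ : Ctx) : Countable (Fm Γ) :=
  Set.countable_univ_iff.1 ((Set.countable_iUnion fun n => Fm.countable_height n Γ).mono
    fun t _ => Set.mem_iUnion.2 ⟨t.height + 1, Nat.lt_succ_self _⟩)

instance (Γ : Ctx) : Nonempty (Fm Γ) := ⟨.bot⟩

end SysP

namespace SysP

variable {Γ Δ Θ : Ctx} {σ τ : Ty}

/-! ## Structures for the language -/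

/-- Interpretation of the types, of application, of terms and of standardness. -/
structure Str where
  Carrier : Ty → Type
  app : ∀ {σ τ : Ty}, Carrier (σ ⇒ τ) → Carrier σ → Carrier τ
  ev : ∀ {Γ : Ctx} {σ : Ty}, Tm Γ σ → (∀ τ : Ty, Var Γ τ → Carrier τ) → Carrier σ
  St : ∀ {σ : Ty}, Carrier σ → Prop

/-- Environments. -/
abbrev Str.Env (M : Str) (Γ : Ctx) : Type := ∀ τ : Ty, Var Γ τ → M.Carrier τ

/-- Extend an environment. -/
def Str.push {M : Str} (a : M.Carrier τ) (e : M.Env Γ) : M.Env (τ :: Γ)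
  | _, Var.vz => a
  | _, Var.vs x => e _ x

/-- Tarski semantics. -/
def Str.Sat (M : Str) : {Γ : Ctx} → Fm Γ → M.Env Γ → Prop
  | _, .eq a b, e => M.ev a e = M.ev b e
  | _, .st a, e => M.St (M.ev a e)
  | _, .bot, _ => False
  | _, .conj φ ψ, e => M.Sat φ e ∧ M.Sat ψ e
  | _, .disj φ ψ, e => M.Sat φ e ∨ M.Sat ψ e
  | _, .imp φ ψ, e => M.Sat φ e → M.Sat ψ e
  | _, .all σ φ, e => ∀ a : M.Carrier σ, M.Sat φ (Str.push a e)
  | _, .ex σ φ, e => ∃ a : M.Carrier σ, M.Sat φ (Str.push a e)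

/-- Extensional structures in which the terms have their intended meaning. -/
structure LambdaModel extends Str where
  ev_var : ∀ {Γ : Ctx} {σ : Ty} (x : Var Γ σ) (e : toStr.Env Γ), ev (.var x) e = e σ x
  ev_app : ∀ {Γ : Ctx} {σ τ : Ty} (f : Tm Γ (σ ⇒ τ)) (a : Tm Γ σ) (e : toStr.Env Γ),
    ev (f ⬝ a) e = app (ev f e) (ev a e)
  ev_rename : ∀ {Γ Δ : Ctx} {σ : Ty} (t : Tm Γ σ) (r : Ren Γ Δ) (e : toStr.Env Δ),
    ev (t.rename r) e = ev t (fun τ x => e τ (r τ x))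
  ev_lam : ∀ {Γ : Ctx} {σ τ : Ty} (b : Tm (σ :: Γ) τ) (e : toStr.Env Γ) (a : Carrier σ),
    app (ev (.lam b) e) a = ev b (Str.push a e)
  app_ext : ∀ {σ τ : Ty} (f g : Carrier (σ ⇒ τ)), (∀ a, app f a = app g a) → f = g

/-- The models of the fragment of `P` given by the axioms for zero, the recursors, induction,
standardness and external induction. -/
structure Model extends LambdaModel where
  succ_ne_zero : ∀ {Γ : Ctx} (e : toStr.Env Γ) (a : Carrier ty0),
    app (ev .succ e) a ≠ ev .zero e
  recN_zero : ∀ {Γ : Ctx} (e : toStr.Env Γ) {ρ : Ty} (y : Carrier ρ)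
    (z : Carrier (ρ ⇒ ty0 ⇒ ρ)), app (app (app (ev (.recN ρ) e) (ev .zero e)) y) z = y
  recN_succ : ∀ {Γ : Ctx} (e : toStr.Env Γ) {ρ : Ty} (n : Carrier ty0) (y : Carrier ρ)
    (z : Carrier (ρ ⇒ ty0 ⇒ ρ)), app (app (app (ev (.recN ρ) e) (app (ev .succ e) n)) y) z =
      app (app z (app (app (app (ev (.recN ρ) e) n) y) z)) n
  ind : ∀ {Γ : Ctx} (φ : Fm (ty0 :: Γ)), φ.Internal → ∀ e : toStr.Env Γ,
    toStr.Sat φ (Str.push (ev .zero e) e) →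
    (∀ a, toStr.Sat φ (Str.push a e) → toStr.Sat φ (Str.push (app (ev .succ e) a) e)) →
    ∀ a, toStr.Sat φ (Str.push a e)
  st_closed : ∀ {Γ : Ctx} {σ : Ty} (t : CTm σ) (e : toStr.Env Γ), St (ev t.closed e)
  st_app : ∀ {σ τ : Ty} (f : Carrier (σ ⇒ τ)) (a : Carrier σ), St f → St a → St (app f a)
  ind_st : ∀ {Γ : Ctx} (φ : Fm (ty0 :: Γ)) (e : toStr.Env Γ),
    toStr.Sat φ (Str.push (ev .zero e) e) →
    (∀ a, St a → toStr.Sat φ (Str.push a e) → toStr.Sat φ (Str.push (app (ev .succ e) a) e)) →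
    ∀ a, St a → toStr.Sat φ (Str.push a e)

namespace LambdaModel

variable (M : LambdaModel)

theorem ev_wk (t : Tm Γ σ) (a : M.Carrier τ) (e : M.Env Γ) :
    M.ev (t.wk τ) (Str.push a e) = M.ev t e := M.ev_rename _ _ _

/-- Only compatibility with renaming is part of a `LambdaModel`. For substitution the abstraction
case follows from β and extensionality, and the constants are closed, so their value does not depend
on the environment. -/
theorem ev_subst (t : Tm Γ σ) : ∀ {Δ : Ctx} (s : Sub Γ Δ) (e : M.Env Δ),
    M.ev (t.subst s) e = M.ev t (fun τ x => M.ev (s τ x) e) := by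
  have key : ∀ {σ : Ty} (t : Tm [] σ) {Γ Δ : Ctx} (e : M.Env Γ) (e' : M.Env Δ),
      M.ev t.closed e = M.ev t.closed e' := by
    intro σ t Γ Δ e e'
    rw [Tm.closed, Tm.closed, M.ev_rename, M.ev_rename]
    congr 1
    funext τ x
    cases x
  induction t with
  | var x => intro Δ s e; rw [M.ev_var]; rfl
  | app f a ihf iha => intro Δ s e; rw [M.ev_app, ← ihf, ← iha]; exact M.ev_app _ _ _
  | lam b ih =>
    intro Δ s e
    refine M.app_ext _ _ fun a => ?_
    rw [Tm.subst, M.ev_lam, M.ev_lam, ih]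
    congr 1
    funext τ x
    cases x with
    | vz => exact M.ev_var _ _
    | vs x => exact M.ev_wk _ _ _
  | zero => intro Δ s e; exact key .zero _ _
  | succ => intro Δ s e; exact key .succ _ _
  | recN ρ => intro Δ s e; exact key (.recN ρ) _ _
  | nil σ => intro Δ s e; exact key (.nil σ) _ _
  | cons σ => intro Δ s e; exact key (.cons σ) _ _
  | recL σ ρ => intro Δ s e; exact key (.recL σ ρ) _ _

theorem ev_lift (s : Sub Γ Δ) (a : M.Carrier σ) (e : M.Env Δ) :
    (fun τ x => M.ev (s.lift σ τ x) (Str.push a e)) =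
      (Str.push a (fun τ x => M.ev (s τ x) e) : M.Env (σ :: Γ)) := by
  funext τ x
  cases x with
  | vz => exact M.ev_var _ _
  | vs x => exact M.ev_wk _ _ _

theorem sat_subst (φ : Fm Γ) : ∀ {Δ : Ctx} (s : Sub Γ Δ) (e : M.Env Δ),
    M.Sat (φ.subst s) e ↔ M.Sat φ (fun τ x => M.ev (s τ x) e) := by
  induction φ with
  | eq a b => intro Δ s e; simp only [Fm.subst, Str.Sat, ev_subst]
  | st a => intro Δ s e; simp only [Fm.subst, Str.Sat, ev_subst]
  | bot => intro Δ s e; exact Iff.rfl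
  | conj φ ψ h1 h2 => intro Δ s e; exact and_congr (h1 s e) (h2 s e)
  | disj φ ψ h1 h2 => intro Δ s e; exact or_congr (h1 s e) (h2 s e)
  | imp φ ψ h1 h2 => intro Δ s e; exact imp_congr (h1 s e) (h2 s e)
  | all σ φ ih =>
    intro Δ s e
    refine forall_congr' fun a => ?_
    rw [ih, ev_lift]
  | ex σ φ ih =>
    intro Δ s e
    refine exists_congr fun a => ?_
    rw [ih, ev_lift]

theorem sat_inst (φ : Fm (σ :: Γ)) (a : Tm Γ σ) (e : M.Env Γ) :
    M.Sat (φ.inst a) e ↔ M.Sat φ (Str.push (M.ev a e) e) := by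
  rw [Fm.inst, sat_subst]
  apply iff_of_eq
  congr 1
  funext τ x
  cases x with
  | vz => rfl
  | vs x => exact M.ev_var _ _

theorem ev_const (t : CTm σ) (e : M.Env Γ) (e' : M.Env Δ) : M.ev t.closed e = M.ev t.closed e' := by
  rw [Tm.closed, Tm.closed, M.ev_rename, M.ev_rename]
  congr 1
  funext τ x
  cases x

theorem sat_next (φ : Fm (ty0 :: Γ)) (a : M.Carrier ty0) (e : M.Env Γ) :
    M.Sat (φ.subst Sub.next) (Str.push a e) ↔
      M.Sat φ (Str.push (M.app (M.ev .succ e) a) e) := by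
  rw [sat_subst]
  apply iff_of_eq
  congr 1
  funext τ x
  cases x with
  | vz =>
    change M.ev (.succ ⬝ v0) (Str.push a e) = M.app (M.ev .succ e) a
    rw [M.ev_app, M.ev_var]
    exact congrArg (fun f => M.app f a) (M.ev_const .succ _ _)
  | vs x => exact M.ev_var _ _

end LambdaModel

/-! ## Henkin's construction -/

theorem Prf.exFalso {H : List (Fm Γ)} {φ : Fm Γ} (h : Prf H .bot) : Prf H φ :=
  .impE (.impI (.raa (.hyp (.tail _ (.head _))))) h

/-- A fresh variable adds no strength, because every type has a closed term to put in its place. -/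
theorem Prf.bot_of_wk {H : List (Fm Γ)} (h : Prf (H.map (Fm.wk τ)) .bot) : Prf H .bot :=
  .allE (zeroT τ) (.allI h)

/-- The type of a witness of an existential formula. -/
def Fm.witTy : Fm Γ → Ty
  | .ex σ _ => σ
  | _ => ty0

/-- The formula that a witness of an existential formula satisfies. -/
def Fm.wit : (φ : Fm Γ) → Fm (φ.witTy :: Γ)
  | .ex _ χ => χ
  | .eq a b => (Fm.eq a b).wk _
  | .st a => (Fm.st a).wk _
  | .bot => Fm.bot.wk _
  | .conj φ ψ => (Fm.conj φ ψ).wk _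
  | .disj φ ψ => (Fm.disj φ ψ).wk _
  | .imp φ ψ => (Fm.imp φ ψ).wk _
  | .all σ φ => (Fm.all σ φ).wk _

/-- Adding a witness preserves consistency: for an existential formula this is existential
elimination; for any other formula the witness is a dummy variable and the added formula a weakened
copy. -/
theorem Prf.bot_of_wit {H : List (Fm Γ)} {φ : Fm Γ}
    (h : Prf (φ.wit :: (φ :: H).map (Fm.wk φ.witTy)) .bot) : Prf (φ :: H) .bot := by
  have key : ∀ τ, Prf (φ.wk τ :: (φ :: H).map (Fm.wk τ)) .bot → Prf (φ :: H) .bot := fun τ h =>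
    Prf.bot_of_wk (.impE (.impI h) (.hyp (.head _)))
  cases φ with
  | ex σ χ => exact .exE (.hyp (.head _)) h
  | _ => exact key _ h

/-- A stage of the construction: a context, a list of formulas, and the formulas that are still to
be decided. -/
structure HStage where
  ctx : Ctx
  hyps : List (Fm ctx)
  queue : ℕ → ℕ → Fm ctx

open Classical in
/-- The formula or its negation, whichever is consistent with the list. -/
noncomputable def choice (H : List (Fm Γ)) (φ : Fm Γ) : Fm Γ :=
  if Prf (φ :: H) .bot then φ.neg else φ

/-- An enumeration of the formulas. -/
noncomputable def enumFm (Γ : Ctx) : ℕ → Fm Γ := (exists_surjective_nat (Fm Γ)).choose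

theorem enumFm_surjective (Γ : Ctx) : Function.Surjective (enumFm Γ) :=
  (exists_surjective_nat (Fm Γ)).choose_spec

/-- Add a formula and a witness of it. -/
noncomputable def HStage.add (s : HStage) (n : ℕ) (φ : Fm s.ctx) : HStage where
  ctx := φ.witTy :: s.ctx
  hyps := φ.wit :: (φ :: s.hyps).map (Fm.wk _)
  queue m i := if m = n + 1 then enumFm _ i else (s.queue m i).wk _

/-- The formula to be decided at the stage `n`. -/
def HStage.goal (s : HStage) (n : ℕ) : Fm s.ctx := s.queue n.unpair.1 n.unpair.2

/-- Each stage decides one formula and adds one variable. Row `m` of the queue lists all formulas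
over the context of stage `m`, weakened to the current context. Rows beyond the current stage hold
placeholders, which are never read since `n.unpair.1 ≤ n`. -/
noncomputable def henkin (φ : Fm []) : ℕ → HStage
  | 0 => ⟨[], [φ], fun _ => enumFm []⟩
  | n + 1 => (henkin φ n).add n (choice (henkin φ n).hyps ((henkin φ n).goal n))

/-- The negation is chosen only if the formula is refutable. If the negation were refutable as well,
the previous stage would already be inconsistent. -/
theorem henkin_consistent {φ : Fm []} (h : ¬ Prf [φ] .bot) (n : ℕ) :
    ¬ Prf (henkin φ n).hyps .bot := by
  induction n with
  | zero => exact h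
  | succ n ih =>
    intro hb
    have h1 := Prf.bot_of_wit hb
    unfold choice at h1
    split_ifs at h1 with h2
    · exact ih (.impE (.impI h2) (.raa h1))
    · exact h2 h1

section Limit

variable (φ₀ : Fm [])

/-- The contexts of the construction. -/
noncomputable abbrev hctx (n : ℕ) : Ctx := (henkin φ₀ n).ctx

/-- The type of the variable added at the stage `n`. -/
noncomputable abbrev hty (n : ℕ) : Ty :=
  (choice (henkin φ₀ n).hyps ((henkin φ₀ n).goal n)).witTy

/-- The formulas of the construction. -/
noncomputable abbrev hhyps (n : ℕ) : List (Fm (hctx φ₀ n)) := (henkin φ₀ n).hyps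

variable {φ₀}

/-- Families of formulas that are eventually constant, up to weakening. -/
def CompatFm (s : ∀ n, Fm (hctx φ₀ n)) : Prop :=
  ∀ᶠ n in Filter.atTop, s (n + 1) = (s n).wk (hty φ₀ n)

theorem mem_hhyps_succ {n : ℕ} {ψ : Fm (hctx φ₀ n)} (h : ψ ∈ hhyps φ₀ n) :
    ψ.wk (hty φ₀ n) ∈ hhyps φ₀ (n + 1) :=
  .tail _ (List.mem_map_of_mem (.tail _ h))

theorem choice_mem (n : ℕ) :
    (choice (hhyps φ₀ n) ((henkin φ₀ n).goal n)).wk (hty φ₀ n) ∈ hhyps φ₀ (n + 1) :=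
  .tail _ (List.mem_map_of_mem (.head _))

theorem CompatFm.eventually_mem {s : ∀ n, Fm (hctx φ₀ n)} {N : ℕ}
    (hs : ∀ n ≥ N, s (n + 1) = (s n).wk (hty φ₀ n)) (h : s N ∈ hhyps φ₀ N) :
    ∀ᶠ n in Filter.atTop, s n ∈ hhyps φ₀ n := by
  refine Filter.eventually_atTop.2 ⟨N, fun n hn => ?_⟩
  induction n, hn using Nat.le_induction with
  | base => exact h
  | succ n hn ih => rw [hs n hn]; exact mem_hhyps_succ ih

theorem queue_self (N i : ℕ) : (henkin φ₀ N).queue N i = enumFm _ i := by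
  cases N with
  | zero => rfl
  | succ n => exact if_pos rfl

/-- Once the family is stable from `N` on, its member at `N` is entry `i` of row `N` for some `i`.
The queue weakens this entry just as the family does, and it is decided at stage `Nat.pair N i ≥ N`.
-/
theorem CompatFm.exists_goal {s : ∀ n, Fm (hctx φ₀ n)} (hs : CompatFm s) :
    ∃ n, (henkin φ₀ n).goal n = s n ∧ ∀ k ≥ n, s (k + 1) = (s k).wk (hty φ₀ k) := by
  obtain ⟨N, hN⟩ := Filter.eventually_atTop.1 hs
  obtain ⟨i, hi⟩ := enumFm_surjective _ (s N)
  have key : ∀ n ≥ N, (henkin φ₀ n).queue N i = s n := by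
    intro n hn
    induction n, hn using Nat.le_induction with
    | base => rw [queue_self, hi]
    | succ n hn ih =>
      rw [hN n hn, ← ih]
      exact if_neg (by omega)
  refine ⟨Nat.pair N i, ?_, fun k hk => hN k ((Nat.left_le_pair N i).trans hk)⟩
  rw [HStage.goal, Nat.unpair_pair]
  exact key _ (Nat.left_le_pair N i)

theorem CompatFm.mem_or_neg_mem {s : ∀ n, Fm (hctx φ₀ n)} (hs : CompatFm s) :
    (∀ᶠ n in Filter.atTop, s n ∈ hhyps φ₀ n) ∨
      ∀ᶠ n in Filter.atTop, (s n).neg ∈ hhyps φ₀ n := by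
  obtain ⟨n, hn, hk⟩ := hs.exists_goal
  have h := choice_mem (φ₀ := φ₀) n
  rw [hn] at h
  rcases em (Prf (s n :: hhyps φ₀ n) .bot) with hp | hp
  · right
    refine CompatFm.eventually_mem (N := n + 1) (fun k hk' => ?_) ?_
    · rw [hk k (by omega)]; rfl
    · rw [hk n le_rfl]
      have e : choice (hhyps φ₀ n) (s n) = (s n).neg := if_pos hp
      rw [e] at h
      exact h
  · left
    refine CompatFm.eventually_mem (N := n + 1) (fun k hk' => hk k (by omega)) ?_
    rw [hk n le_rfl]
    have e : choice (hhyps φ₀ n) (s n) = s n := if_neg hp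
    rw [e] at h
    exact h

/-- Truth in the limit. -/
def Holds (s : ∀ n, Fm (hctx φ₀ n)) : Prop := ∀ᶠ n in Filter.atTop, Prf (hhyps φ₀ n) (s n)

theorem CompatFm.holds_iff_mem (hc : ¬ Prf [φ₀] .bot) {s : ∀ n, Fm (hctx φ₀ n)} (hs : CompatFm s) :
    Holds s ↔ ∀ᶠ n in Filter.atTop, s n ∈ hhyps φ₀ n := by
  refine ⟨fun h => hs.mem_or_neg_mem.resolve_right fun h' => ?_, fun h => h.mono fun n => .hyp⟩
  obtain ⟨n, h1, h2⟩ := (h.and h').exists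
  exact henkin_consistent hc n (.impE (.hyp h2) h1)

theorem CompatFm.holds_neg (hc : ¬ Prf [φ₀] .bot) {s : ∀ n, Fm (hctx φ₀ n)} (hs : CompatFm s) :
    Holds (fun n => (s n).neg) ↔ ¬ Holds s := by
  refine ⟨fun h h' => ?_, fun h => ?_⟩
  · obtain ⟨n, h1, h2⟩ := (h.and h').exists
    exact henkin_consistent hc n (.impE h1 h2)
  · exact (hs.mem_or_neg_mem.resolve_left fun h' => h ((hs.holds_iff_mem hc).2 h')).mono
      fun n => .hyp

/-- Terms of the limit. -/
def LimTm (φ₀ : Fm []) (σ : Ty) : Type :=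
  {t : ∀ n, Tm (hctx φ₀ n) σ // ∀ᶠ n in Filter.atTop, t (n + 1) = (t n).wk (hty φ₀ n)}

theorem Tm.wk_inst (a : Tm Γ σ) (b : Tm Γ τ) : (a.wk τ).subst (Sub.one b) = a := by
  rw [Tm.wk, Tm.subst_rename]; exact Tm.subst_var a

theorem Fm.inst_wk (φ : Fm (σ :: Γ)) (a : Tm Γ σ) (τ : Ty) :
    (φ.inst a).wk τ = (φ.rename ((Ren.shift τ).lift σ)).inst (a.wk τ) := by
  rw [Fm.inst, Fm.inst, Fm.wk, Fm.rename_subst, Fm.subst_rename]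
  congr 1
  funext υ x
  cases x <;> rfl

/-- The eigenvariable case: the bound variable is replaced by the newest free variable. -/
theorem Fm.rename_lift_shift_inst (χ : Fm (σ :: Γ)) :
    (χ.rename ((Ren.shift σ).lift σ)).inst v0 = χ := by
  rw [Fm.inst, Fm.subst_rename]
  refine Eq.trans ?_ χ.subst_var
  congr 1
  funext υ x
  cases x <;> rfl

theorem Fm.ex_inj {φ ψ : Fm (σ :: Γ)} (h : Fm.ex σ φ = .ex σ ψ) : φ = ψ := by
  simpa using h

theorem Prf.ex_neg_of_neg_all {H : List (Fm Γ)} {φ : Fm (σ :: Γ)} (h : Prf H (Fm.all σ φ).neg) :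
    Prf H (.ex σ φ.neg) := by
  refine .impE (.impI (.raa (.impE (.hyp (.tail _ (.head _))) (.allI (.raa ?_))))) h
  refine .impE (.hyp (.tail _ (.head _))) (.exI v0 ?_)
  rw [Fm.rename_lift_shift_inst]
  exact .hyp (.head _)

/-- The equation `h` is a hypothesis because the formula treated at a stage is a value of `choice`,
which is existential only up to a proved equality. -/
theorem HStage.exists_wit (s : HStage) (n : ℕ) (φ : Fm s.ctx) (χ : Fm (σ :: s.ctx))
    (h : φ = .ex σ χ) : ∃ a : Tm (s.add n φ).ctx σ,
      (χ.rename ((Ren.shift φ.witTy).lift σ)).inst a ∈ (s.add n φ).hyps := by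
  subst h
  refine ⟨v0, ?_⟩
  have : (χ.rename ((Ren.shift σ).lift σ)).inst v0 ∈ χ :: (Fm.ex σ χ :: s.hyps).map (Fm.wk σ) := by
    rw [Fm.rename_lift_shift_inst]
    exact .head _
  exact this

/-- The term of the limit that a term at the stage `N` gives. -/
noncomputable def LimTm.ofStageFun {N : ℕ} (a : Tm (hctx φ₀ N) σ) : ∀ n, Tm (hctx φ₀ n) σ
  -- Before stage `N` the value is an irrelevant default; only the behaviour from `N` on matters in
  -- the limit.
  | 0 => if h : N = 0 then h ▸ a else zeroT σ
  | n + 1 => if h : N = n + 1 then h ▸ a else (LimTm.ofStageFun a n).wk (hty φ₀ n)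

theorem LimTm.ofStageFun_self : ∀ {N : ℕ} (a : Tm (hctx φ₀ N) σ), ofStageFun a N = a
  | 0, _ => by simp [ofStageFun]
  | _ + 1, _ => by simp [ofStageFun]

theorem LimTm.ofStageFun_succ {N : ℕ} (a : Tm (hctx φ₀ N) σ) {n : ℕ} (h : N ≤ n) :
    ofStageFun a (n + 1) = (ofStageFun a n).wk (hty φ₀ n) :=
  dif_neg (by omega)

/-- An existential formula true in the limit is the formula chosen when its turn comes, since
otherwise its negation would be true too. The variable added at that stage is the witness. -/
theorem CompatFm.exists_of_holds (hc : ¬ Prf [φ₀] .bot) {χ : ∀ n, Fm (σ :: hctx φ₀ n)}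
    (hs : CompatFm fun n => .ex σ (χ n)) (h : Holds fun n => .ex σ (χ n)) :
    ∃ a : LimTm φ₀ σ, Holds fun n => (χ n).inst (a.1 n) := by
  obtain ⟨n, hn, hk⟩ := hs.exists_goal
  have hch : choice (hhyps φ₀ n) ((henkin φ₀ n).goal n) = .ex σ (χ n) := by
    rw [hn]
    refine if_neg fun hp => ?_
    have h' := choice_mem (φ₀ := φ₀) n
    have e : choice (hhyps φ₀ n) ((henkin φ₀ n).goal n) = Fm.neg (.ex σ (χ n)) := by
      rw [hn]; exact if_pos hp
    rw [e] at h'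
    refine (hs.holds_neg hc).1 (Filter.Eventually.mono ?_ fun _ => Prf.hyp) h
    refine CompatFm.eventually_mem (N := n + 1) (fun k hk' => ?_) ?_
    · rw [hk k (by omega)]; rfl
    · rw [hk n le_rfl]; exact h'
  have hk' : ∀ k ≥ n, χ (k + 1) = (χ k).rename ((Ren.shift (hty φ₀ k)).lift σ) := by
    intro k hkn
    exact Fm.ex_inj (hk k hkn)
  obtain ⟨a, ha⟩ := (henkin φ₀ n).exists_wit n _ _ hch
  let a' : Tm (hctx φ₀ (n + 1)) σ := a
  refine ⟨⟨LimTm.ofStageFun a', Filter.eventually_atTop.2 ⟨n + 1, fun k hk =>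
    LimTm.ofStageFun_succ a' hk⟩⟩, ?_⟩
  refine (CompatFm.eventually_mem (N := n + 1) (fun k hkn => ?_) ?_).mono fun _ => Prf.hyp
  · simp only
    rw [Fm.inst_wk, hk' k (by omega), LimTm.ofStageFun_succ a' hkn]
    rfl
  · simp only
    rw [hk' n le_rfl, LimTm.ofStageFun_self a']
    exact ha

/-- Equality in the limit is provable equality. -/
instance limSetoid (φ₀ : Fm []) (σ : Ty) : Setoid (LimTm φ₀ σ) where
  r a b := Holds fun n => .eq (a.1 n) (b.1 n)
  iseqv := by
    refine ⟨fun a => .of_forall fun n => .eq_refl _, fun {a b} h => h.mono fun n hn => ?_,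
      fun {a b c} h h' => (h.and h').mono fun n hn => ?_⟩
    · have := Prf.eq_subst (.eq v0 ((a.1 n).wk _)) hn
      simp only [Fm.inst, Fm.subst, Tm.wk_inst] at this
      exact this (.eq_refl _)
    · have := Prf.eq_subst (.eq ((a.1 n).wk _) v0) hn.2
      simp only [Fm.inst, Fm.subst, Tm.wk_inst] at this
      exact this hn.1

theorem LimTm.congr {a b : LimTm φ₀ σ} (h : a ≈ b) {χ : ∀ n, Fm (σ :: hctx φ₀ n)}
    (ha : Holds fun n => (χ n).inst (a.1 n)) : Holds fun n => (χ n).inst (b.1 n) :=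
  (Filter.Eventually.and h ha).mono fun _ hn => .eq_subst _ hn.1 hn.2

theorem LimTm.congr_iff {a b : LimTm φ₀ σ} (h : a ≈ b) (χ : ∀ n, Fm (σ :: hctx φ₀ n)) :
    (Holds fun n => (χ n).inst (a.1 n)) ↔ Holds fun n => (χ n).inst (b.1 n) :=
  ⟨LimTm.congr h, LimTm.congr (Setoid.symm h)⟩

/-- Environments in the limit, evaluated at a stage. -/
noncomputable def LimTm.sub (e : ∀ τ, Var Γ τ → LimTm φ₀ τ) (n : ℕ) : Sub Γ (hctx φ₀ n) := fun τ x => (e τ x).1 n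

theorem eventually_forall_var {p : ℕ → ∀ τ, Var Γ τ → Prop}
    (h : ∀ τ x, ∀ᶠ n in Filter.atTop, p n τ x) : ∀ᶠ n in Filter.atTop, ∀ τ x, p n τ x := by
  induction Γ with
  | nil => exact .of_forall fun n τ x => nomatch x
  | cons σ Γ ih =>
    filter_upwards [h σ .vz, ih (p := fun n τ x => p n τ (.vs x)) fun τ x => h τ (.vs x)]
      with n h1 h2 τ x
    cases x with
    | vz => exact h1
    | vs x => exact h2 τ x

theorem LimTm.eventually_sub (e : ∀ τ, Var Γ τ → LimTm φ₀ τ) :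
    ∀ᶠ n in Filter.atTop, sub e (n + 1) = fun τ x => (sub e n τ x).wk (hty φ₀ n) :=
  (eventually_forall_var fun τ x => (e τ x).2).mono fun n hn => by funext τ x; exact hn τ x

/-- A term of the limit by substitution. -/
noncomputable def LimTm.subst (t : Tm Γ σ) (e : ∀ τ, Var Γ τ → LimTm φ₀ τ) : LimTm φ₀ σ :=
  ⟨fun n => t.subst (sub e n), (eventually_sub e).mono fun _ hn =>
    (congrArg (fun s => t.subst s) hn).trans (t.rename_subst _ _).symm⟩

theorem LimTm.compat_subst (φ : Fm Γ) (e : ∀ τ, Var Γ τ → LimTm φ₀ τ) :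
    CompatFm fun n => φ.subst (sub e n) :=
  (eventually_sub e).mono fun _ hn =>
    (congrArg (fun s => φ.subst s) hn).trans (φ.rename_subst _ _).symm

/-- The term model. -/
noncomputable def termStr (φ₀ : Fm []) : Str where
  Carrier σ := Quotient (limSetoid φ₀ σ)
  app f a := ⟦⟨fun n => f.out.1 n ⬝ a.out.1 n, by
    filter_upwards [f.out.2, a.out.2] with n h1 h2
    rw [h1, h2]; rfl⟩⟧
  ev t e := ⟦LimTm.subst t fun τ x => (e τ x).out⟧
  St a := Holds fun n => .st (a.out.1 n)

/-- Representatives of an environment. -/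
noncomputable def reps (e : (termStr φ₀).Env Γ) : ∀ τ, Var Γ τ → LimTm φ₀ τ :=
  fun τ x => Quotient.out (e τ x)

theorem sub_reps_push (a : (termStr φ₀).Carrier σ) (e : (termStr φ₀).Env Γ) (n : ℕ) :
    LimTm.sub (reps (Str.push a e)) n = Sub.cons ((Quotient.out a).1 n) (LimTm.sub (reps e) n) := by
  funext τ x; cases x <;> rfl

/-- A witness in the quotient and a witness among limit terms amount to the same, as truth in the
limit respects provable equality. -/
theorem exists_holds_iff {e : (termStr φ₀).Env Γ} (φ : Fm (σ :: Γ)) :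
    (∃ a : (termStr φ₀).Carrier σ, Holds fun n => φ.subst (LimTm.sub (reps (Str.push a e)) n)) ↔
      ∃ a : LimTm φ₀ σ, Holds fun n => (φ.subst ((LimTm.sub (reps e) n).lift σ)).inst (a.1 n) := by
  simp only [sub_reps_push, ← Fm.inst_subst_lift]
  constructor
  · rintro ⟨a, ha⟩; exact ⟨_, ha⟩
  · rintro ⟨a, ha⟩
    exact ⟨⟦a⟧, LimTm.congr (Setoid.symm (Quotient.mk_out a)) ha⟩

/-- The truth lemma. Disjunction and implication use that every formula is decided; existence uses
the witnesses; the universal quantifier is reduced to a witness of the negated formula. -/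
theorem sat_termStr (hc : ¬ Prf [φ₀] .bot) (φ : Fm Γ) : ∀ e : (termStr φ₀).Env Γ,
    (termStr φ₀).Sat φ e ↔ Holds fun n => φ.subst (LimTm.sub (reps e) n) := by
  induction φ with
  | eq a b =>
    intro e
    exact Quotient.eq
  | st a =>
    intro e
    exact LimTm.congr_iff (Quotient.mk_out (LimTm.subst a (reps e))) fun n => .st v0
  | bot =>
    intro e
    refine ⟨False.elim, fun h => ?_⟩
    obtain ⟨n, hn⟩ := Filter.Eventually.exists h
    exact henkin_consistent hc n hn
  | conj φ ψ ih1 ih2 =>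
    intro e
    refine (and_congr (ih1 e) (ih2 e)).trans ⟨fun h => (h.1.and h.2).mono fun n hn =>
      .conjI hn.1 hn.2, fun h => ⟨h.mono fun n hn => .conjE1 hn, h.mono fun n hn => .conjE2 hn⟩⟩
  | disj φ ψ ih1 ih2 =>
    intro e
    refine (or_congr (ih1 e) (ih2 e)).trans ⟨?_, fun h => ?_⟩
    · rintro (h | h)
      · exact h.mono fun n hn => .disjI1 hn
      · exact h.mono fun n hn => .disjI2 hn
    · rcases (LimTm.compat_subst φ (reps e)).mem_or_neg_mem with h1 | h1
      · exact .inl (h1.mono fun n => .hyp)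
      · refine .inr ((h.and h1).mono fun n hn => ?_)
        exact .disjE hn.1 (.exFalso (.impE (.hyp (.tail _ hn.2)) (.hyp (.head _))))
          (.hyp (.head _))
  | imp φ ψ ih1 ih2 =>
    intro e
    refine (imp_congr (ih1 e) (ih2 e)).trans ⟨fun h => ?_, fun h h' => (h.and h').mono
      fun n hn => .impE hn.1 hn.2⟩
    rcases (LimTm.compat_subst φ (reps e)).mem_or_neg_mem with h1 | h1
    · refine (((LimTm.compat_subst ψ (reps e)).holds_iff_mem hc).1
        (h (h1.mono fun n => .hyp))).mono fun n hn => ?_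
      exact .impI (.hyp (.tail _ hn))
    · refine h1.mono fun n hn => ?_
      exact .impI (.exFalso (.impE (.hyp (.tail _ hn)) (.hyp (.head _))))
  | all σ φ ih =>
    intro e
    constructor
    · intro h
      by_contra hn
      have h1 := ((LimTm.compat_subst (.all σ φ) (reps e)).holds_neg hc).2 hn
      have h2 : Holds fun n => (Fm.ex σ φ.neg).subst (LimTm.sub (reps e) n) := by
        exact h1.mono fun n h1 => .ex_neg_of_neg_all h1
      obtain ⟨a, ha⟩ := (exists_holds_iff φ.neg).2
        ((LimTm.compat_subst (.ex σ φ.neg) (reps e)).exists_of_holds hc h2)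
      exact ((LimTm.compat_subst φ _).holds_neg hc).1 ha ((ih _).1 (h a))
    · intro h a
      rw [ih]
      refine h.mono fun n hn => ?_
      have h1 : Prf _ ((φ.subst ((LimTm.sub (reps e) n).lift σ)).inst ((Quotient.out a).1 n)) :=
        .allE _ hn
      rwa [Fm.inst_subst_lift, ← sub_reps_push] at h1
  | ex σ φ ih =>
    intro e
    refine (exists_congr fun a => ih (Str.push a e)).trans ((exists_holds_iff φ).trans ?_)
    constructor
    · rintro ⟨a, ha⟩
      exact ha.mono fun n hn => .exI _ hn
    · exact fun h => (LimTm.compat_subst (.ex σ φ) (reps e)).exists_of_holds hc h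

/-! ### The axioms of `P` in the term model -/

theorem sat_of_ax (hc : ¬ Prf [φ₀] .bot) {φ : Fm Γ}
    (h : ∀ (Δ : Ctx) (s : Sub Γ Δ), AxP (φ.subst s)) (e : (termStr φ₀).Env Γ) :
    (termStr φ₀).Sat φ e :=
  (sat_termStr hc φ e).2 (.of_forall fun _ => .ax (h _ _))

theorem Prf.app_congr {H : List (Fm Γ)} {f g : Tm Γ (σ ⇒ τ)} {a b : Tm Γ σ}
    (hf : Prf H (.eq f g)) (ha : Prf H (.eq a b)) : Prf H (.eq (f ⬝ a) (g ⬝ b)) := by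
  have h1 := Prf.eq_subst (.eq ((f ⬝ a).wk _) (v0 ⬝ a.wk _)) hf
  have h2 := Prf.eq_subst (.eq ((f ⬝ a).wk _) (g.wk _ ⬝ v0)) ha
  simp only [Fm.inst, Fm.subst, Tm.subst, Tm.wk_inst] at h1 h2
  exact h2 (h1 (.eq_refl _))

theorem termStr_ev_app (f : Tm Γ (σ ⇒ τ)) (a : Tm Γ σ) (e : (termStr φ₀).Env Γ) :
    (termStr φ₀).ev (f ⬝ a) e = (termStr φ₀).app ((termStr φ₀).ev f e) ((termStr φ₀).ev a e) := by
  refine Quotient.sound ?_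
  have h1 := Quotient.mk_out (s := limSetoid φ₀ (σ ⇒ τ)) (LimTm.subst f (reps e))
  have h2 := Quotient.mk_out (s := limSetoid φ₀ σ) (LimTm.subst a (reps e))
  refine (Filter.Eventually.and (Setoid.symm h1) (Setoid.symm h2)).mono fun n hn => ?_
  exact .app_congr hn.1 hn.2

theorem termStr_ev_rename (t : Tm Γ σ) (r : Ren Γ Δ) (e : (termStr φ₀).Env Δ) :
    (termStr φ₀).ev (t.rename r) e = (termStr φ₀).ev t (fun τ x => e τ (r τ x)) := by
  refine congrArg (Quotient.mk _) (Subtype.ext ?_)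
  funext n
  exact t.subst_rename _ _

theorem termStr_ev_var (x : Var Γ σ) (e : (termStr φ₀).Env Γ) :
    (termStr φ₀).ev (.var x) e = e σ x := Quotient.out_eq _

theorem Tm.closed_subst (t : CTm σ) (s : Sub Γ Δ) : (t.closed : Tm Γ σ).subst s = t.closed := by
  rw [Tm.closed, Tm.closed, Tm.subst_rename, ← (t.rename _).subst_var, Tm.subst_rename]
  congr 1
  funext τ x
  cases x

theorem Fm.Internal.subst {φ : Fm Γ} : φ.Internal → ∀ {Δ : Ctx} (s : Sub Γ Δ),
    (φ.subst s).Internal := by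
  induction φ with
  | eq => intros; trivial
  | st => exact False.elim
  | bot => intros; trivial
  | conj _ _ h1 h2 => exact fun h _ s => ⟨h1 h.1 s, h2 h.2 s⟩
  | disj _ _ h1 h2 => exact fun h _ s => ⟨h1 h.1 s, h2 h.2 s⟩
  | imp _ _ h1 h2 => exact fun h _ s => ⟨h1 h.1 s, h2 h.2 s⟩
  | all _ _ ih => exact fun h _ s => ih h _
  | ex _ _ ih => exact fun h _ s => ih h _

theorem Fm.inst_subst (φ : Fm (σ :: Γ)) (a : Tm Γ σ) (s : Sub Γ Δ) :
    (φ.inst a).subst s = (φ.subst (s.lift σ)).inst (a.subst s) := by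
  rw [Fm.inst_subst_lift, Fm.inst, Fm.subst_subst, Sub.one_subst]

theorem Fm.next_subst (φ : Fm (ty0 :: Γ)) (s : Sub Γ Δ) :
    (φ.subst Sub.next).subst (s.lift ty0) = (φ.subst (s.lift ty0)).subst Sub.next := by
  rw [Fm.subst_subst, Fm.subst_subst]
  congr 1
  funext τ x
  cases x with
  | vz => rfl
  | vs x => simp only [Sub.next, Tm.subst, Sub.lift, Tm.wk, Tm.subst_rename]; exact
      ((s _ x).subst_rename (Ren.shift ty0) (fun _ x => .var x)).symm.trans (Tm.subst_var _) |>.symm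

/-- The term model as a model of the lambda calculus. -/
noncomputable def termLambda (hc : ¬ Prf [φ₀] .bot) : LambdaModel where
  toStr := termStr φ₀
  ev_var := termStr_ev_var
  ev_app := termStr_ev_app
  ev_rename := termStr_ev_rename
  ev_lam {Γ σ τ} b e a := by
    -- The argument `a` is a semantic object, not a term over `Γ`, so it enters through a new
    -- variable to which the weakened abstraction is applied.
    have h := sat_of_ax hc (φ := .eq ((Tm.lam b).wk σ ⬝ v0) b) (fun Δ s => ?_) (Str.push a e)
    · simp only [Str.Sat, termStr_ev_app, termStr_ev_var, Tm.wk, termStr_ev_rename] at h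
      exact h
    · have h := AxEPA.beta ((b.rename ((Ren.shift σ).lift σ)).subst (s.lift σ)) (s _ .vz)
      rw [Tm.subst_lift_one, Tm.subst_rename b _ (Sub.cons _ _)] at h
      have hs : (fun υ x => Sub.cons (s _ .vz) s υ ((Ren.shift σ).lift σ υ x)) = s := by
        funext υ x; cases x <;> rfl
      rw [hs] at h
      exact .epa h
  app_ext {σ τ} f g h := by
    have := sat_of_ax hc (φ := (.imp (.all σ (.eq (v2 ⬝ v0) (v1 ⬝ v0))) (.eq v1 v0) :
      Fm [σ ⇒ τ, σ ⇒ τ])) (fun Δ s => .epa (.ext (s _ (.vs .vz)) (s _ .vz)))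
      (Str.push g (Str.push f fun _ x => nomatch x))
    simp only [Str.Sat, termStr_ev_app, termStr_ev_var] at this
    exact this h

/-- The term model. -/
noncomputable def termModel (hc : ¬ Prf [φ₀] .bot) : Model where
  toLambdaModel := termLambda hc
  succ_ne_zero {Γ} e a := by
    have h := sat_of_ax hc (φ := (Fm.neg (.eq (.succ ⬝ v0) .zero) : Fm (ty0 :: Γ)))
      (fun Δ s => .epa (.succ_ne_zero (s _ .vz))) (Str.push a e)
    simp only [Str.Sat, termStr_ev_app, termStr_ev_var] at h
    rwa [← (termLambda hc).ev_wk .succ a e, ← (termLambda hc).ev_wk .zero a e]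
  recN_zero {Γ} e {ρ} y z := by
    have h := sat_of_ax hc (φ := (.eq (.recN ρ ⬝ .zero ⬝ v1 ⬝ v0) v1 :
      Fm ((ρ ⇒ ty0 ⇒ ρ) :: ρ :: Γ))) (fun Δ s => .epa (.recN_zero (s _ (.vs .vz)) (s _ .vz)))
      (Str.push z (Str.push y e))
    simp only [Str.Sat, termStr_ev_app, termStr_ev_var] at h
    rwa [← (termLambda hc).ev_wk (.recN ρ) y e, ← (termLambda hc).ev_wk _ z (Str.push y e),
      ← (termLambda hc).ev_wk .zero y e, ← (termLambda hc).ev_wk _ z (Str.push y e)]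
  recN_succ {Γ} e {ρ} n y z := by
    have h := sat_of_ax hc (φ := (.eq (.recN ρ ⬝ (.succ ⬝ v2) ⬝ v1 ⬝ v0)
      (v0 ⬝ (.recN ρ ⬝ v2 ⬝ v1 ⬝ v0) ⬝ v2) : Fm ((ρ ⇒ ty0 ⇒ ρ) :: ρ :: ty0 :: Γ)))
      (fun Δ s => .epa (.recN_succ (s _ (.vs (.vs .vz))) (s _ (.vs .vz)) (s _ .vz)))
      (Str.push z (Str.push y (Str.push n e)))
    simp only [Str.Sat, termStr_ev_app, termStr_ev_var] at h
    rwa [← (termLambda hc).ev_wk (.recN ρ) n e, ← (termLambda hc).ev_wk _ y (Str.push n e),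
      ← (termLambda hc).ev_wk _ z (Str.push y (Str.push n e)),
      ← (termLambda hc).ev_wk .succ n e, ← (termLambda hc).ev_wk _ y (Str.push n e),
      ← (termLambda hc).ev_wk _ z (Str.push y (Str.push n e))]
  ind {Γ} φ hφ e h0 h1 := by
    have h := sat_of_ax hc (φ := .imp (.conj (φ.inst .zero)
      (.all ty0 (.imp φ (φ.subst Sub.next)))) (.all ty0 φ)) (fun Δ s => ?_) e
    · refine h ⟨((termLambda hc).sat_inst _ _ _).2 h0, fun a ha => ?_⟩
      exact ((termLambda hc).sat_next _ _ _).2 (h1 a ha)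
    · have h := AxEPA.ind (φ.subst (s.lift ty0)) (hφ.subst _)
      rw [← Fm.next_subst] at h
      simp only [Fm.subst, Fm.inst_subst]
      exact .epa h
  st_closed {Γ σ} t e := sat_of_ax hc (φ := .st t.closed) (fun Δ s => by
    rw [Fm.subst, Tm.closed_subst]; exact .st_closed t) e
  st_app {σ τ} f a hf ha := by
    have h := sat_of_ax hc (φ := (.imp (.conj (.st v1) (.st v0)) (.st (v1 ⬝ v0)) :
      Fm [σ, σ ⇒ τ])) (fun Δ s => .st_app (s _ (.vs .vz)) (s _ .vz))
      (Str.push a (Str.push f fun _ x => nomatch x))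
    simp only [Str.Sat, termStr_ev_app, termStr_ev_var] at h
    exact h ⟨hf, ha⟩
  ind_st {Γ} φ e h0 h1 := by
    have h := sat_of_ax hc (φ := .imp (.conj (φ.inst .zero)
      (.allSt ty0 (.imp φ (φ.subst Sub.next)))) (.allSt ty0 φ)) (fun Δ s => ?_) e
    · have h := h ⟨((termLambda hc).sat_inst _ _ _).2 h0, fun a hs ha => ?_⟩
      · intro a ha
        refine h a ?_
        simp only [Str.Sat, termStr_ev_var]
        exact ha
      · simp only [Str.Sat, termStr_ev_var] at hs
        exact ((termLambda hc).sat_next _ _ _).2 (h1 a hs ha)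
    · have h := AxP.ind_st (φ.subst (s.lift ty0))
      rw [← Fm.next_subst] at h
      simp only [Fm.subst, Fm.inst_subst]
      exact h

end Limit

/-- What holds in all models is provable. -/
theorem provesP_of_sat {φ : Fm []} (h : ∀ (M : Model) (e : M.Env []), M.Sat φ e) : ProvesP φ := by
  refine .raa ?_
  by_contra hc
  -- The initial hypothesis survives all stages; all substitutions out of the empty context agree,
  -- so any of them expresses its weakening.
  have key : ∀ n (s : Sub [] (hctx φ.neg n)), φ.neg.subst s ∈ hhyps φ.neg n := by
    have hs : ∀ {Δ : Ctx} (s s' : Sub [] Δ), φ.neg.subst s = φ.neg.subst s' := fun s s' => by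
      congr 1; funext τ x; cases x
    intro n
    induction n with
    | zero =>
      intro s
      have h1 : φ.neg.subst s = φ.neg := (hs _ _).trans φ.neg.subst_var
      exact List.mem_singleton.2 h1
    | succ n ih =>
      intro s
      let s' : Sub [] (hctx φ.neg n) := fun τ x => by cases x
      have h1 : φ.neg.subst s = (φ.neg.subst s').wk _ :=
        (hs _ _).trans (φ.neg.rename_subst s' (Ren.shift (hty φ.neg n))).symm
      exact (congrArg (· ∈ hhyps φ.neg (n + 1)) h1).mpr (mem_hhyps_succ (ih s'))
  have e : (termStr φ.neg).Env [] := fun _ x => by cases x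
  have h1 : (termStr φ.neg).Sat φ.neg e :=
    (sat_termStr hc _ _).2 (.of_forall fun n => .hyp (key n _))
  exact h1 (h (termModel hc) e)

end SysP

namespace SysP

namespace Model

variable (M : Model) {Γ Δ : Ctx} {σ τ : Ty}

/-! ## Arithmetic in a model -/

/-- The numbers of a model. -/
abbrev N : Type := M.Carrier ty0

/-- The empty environment. -/
def nilEnv : M.Env [] := fun _ x => by cases x

/-- The value of a closed term. -/
def val (t : CTm σ) : M.Carrier σ := M.ev t M.nilEnv

theorem ev_closed (t : CTm σ) (e : M.Env Γ) : M.ev t.closed e = M.val t := by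
  rw [Tm.closed, M.ev_rename, val]
  congr 1
  funext τ x
  cases x

instance : Zero M.N := ⟨M.val .zero⟩

/-- The successor function. -/
def S (a : M.N) : M.N := M.app (M.val .succ) a

instance : Add M.N := ⟨fun a b => M.app (M.app (M.val addT) a) b⟩
instance : Mul M.N := ⟨fun a b => M.app (M.app (M.val mulT) a) b⟩
instance : _root_.Sub M.N := ⟨fun a b => M.app (M.app (M.val subT) a) b⟩
instance : One M.N := ⟨M.S 0⟩

def pred (a : M.N) : M.N := M.app (M.val predT) a

/-- Recursion. -/
def recn {ρ : Ty} (n : M.N) (y : M.Carrier ρ) (z : M.Carrier (ρ ⇒ ty0 ⇒ ρ)) : M.Carrier ρ :=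
  M.app (M.app (M.app (M.val (.recN ρ)) n) y) z

@[simp] theorem push_vz (a : M.Carrier τ) (e : M.Env Γ) : Str.push a e τ .vz = a := rfl
@[simp] theorem push_vs (a : M.Carrier τ) (e : M.Env Γ) (x : Var Γ σ) :
    Str.push a e σ (.vs x) = e σ x := rfl

@[simp] theorem ev_var' (x : Var Γ σ) (e : M.Env Γ) : M.ev (.var x) e = e σ x := M.ev_var x e
@[simp] theorem ev_app' (f : Tm Γ (σ ⇒ τ)) (a : Tm Γ σ) (e : M.Env Γ) :
    M.ev (f ⬝ a) e = M.app (M.ev f e) (M.ev a e) := M.ev_app f a e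
@[simp] theorem ev_lam' (b : Tm (σ :: Γ) τ) (e : M.Env Γ) (a : M.Carrier σ) :
    M.app (M.ev (.lam b) e) a = M.ev b (Str.push a e) := M.ev_lam b e a
@[simp] theorem ev_wk' (t : Tm Γ σ) (a : M.Carrier τ) (e : M.Env Γ) :
    M.ev (t.wk τ) (Str.push a e) = M.ev t e := M.ev_wk t a e
@[simp] theorem ev_zero (e : M.Env Γ) : M.ev .zero e = 0 := M.ev_closed .zero e
@[simp] theorem app_succ (e : M.Env Γ) (a : M.N) : M.app (M.ev .succ e) a = M.S a :=
  congrArg (M.app · a) (M.ev_closed .succ e)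
@[simp] theorem app_recN (e : M.Env Γ) {ρ : Ty} (n : M.N) (y : M.Carrier ρ)
    (z : M.Carrier (ρ ⇒ ty0 ⇒ ρ)) :
    M.app (M.app (M.app (M.ev (.recN ρ) e) n) y) z = M.recn n y z :=
  congrArg (fun f => M.app (M.app (M.app f n) y) z) (M.ev_closed (.recN ρ) e)
@[simp] theorem app_addT (e : M.Env Γ) (a b : M.N) : M.app (M.app (M.ev addT e) a) b = a + b :=
  congrArg (fun f => M.app (M.app f a) b) (M.ev_closed addT e)
@[simp] theorem app_mulT (e : M.Env Γ) (a b : M.N) : M.app (M.app (M.ev mulT e) a) b = a * b :=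
  congrArg (fun f => M.app (M.app f a) b) (M.ev_closed mulT e)
@[simp] theorem app_subT (e : M.Env Γ) (a b : M.N) : M.app (M.app (M.ev subT e) a) b = a - b :=
  congrArg (fun f => M.app (M.app f a) b) (M.ev_closed subT e)
@[simp] theorem app_predT (e : M.Env Γ) (a : M.N) : M.app (M.ev predT e) a = M.pred a :=
  congrArg (M.app · a) (M.ev_closed predT e)

@[simp] theorem recn_zero {ρ : Ty} (y : M.Carrier ρ) (z : M.Carrier (ρ ⇒ ty0 ⇒ ρ)) :
    M.recn 0 y z = y := M.recN_zero M.nilEnv y z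
@[simp] theorem recn_succ {ρ : Ty} (n : M.N) (y : M.Carrier ρ) (z : M.Carrier (ρ ⇒ ty0 ⇒ ρ)) :
    M.recn (M.S n) y z = M.app (M.app z (M.recn n y z)) n := M.recN_succ M.nilEnv n y z

/-- For the recursion equations: unfolding a defined function at `S n` and at `n` leaves the same
step function in two environments that differ in the recursion argument. The body does not use that
entry, so extensionality identifies the two. -/
theorem lam_lam_congr {ρ : Ty} {b : Tm (τ :: σ :: Γ) ρ} {b' : Tm (τ :: σ :: Δ) ρ}
    {e : M.Env Γ} {e' : M.Env Δ}
    (h : ∀ x y, M.ev b (Str.push y (Str.push x e)) = M.ev b' (Str.push y (Str.push x e'))) :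
    M.ev (.lam (.lam b)) e = M.ev (.lam (.lam b')) e' :=
  M.app_ext _ _ fun x => M.app_ext _ _ fun y => by simpa using h x y

theorem S_ne_zero (a : M.N) : M.S a ≠ 0 := M.succ_ne_zero M.nilEnv a
/-- Induction for definable predicates. -/
theorem induction (φ : Fm (ty0 :: Γ)) (e : M.Env Γ) {P : M.N → Prop}
    (hP : ∀ n, M.Sat φ (Str.push n e) ↔ P n) (h0 : P 0) (hs : ∀ n, P n → P (M.S n)) (n : M.N)
    (hφ : φ.Internal := by simp [Fm.Internal]) : P n := by
  refine (hP n).1 (M.ind φ hφ e ?_ (fun a ha => ?_) n)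
  · rw [M.ev_zero, hP]; exact h0
  · rw [M.app_succ, hP]; exact hs a ((hP a).1 ha)

/-- External induction. -/
theorem induction_st (φ : Fm (ty0 :: Γ)) (e : M.Env Γ) {P : M.N → Prop}
    (hP : ∀ n, M.Sat φ (Str.push n e) ↔ P n) (h0 : P 0)
    (hs : ∀ n, M.St n → P n → P (M.S n)) (n : M.N) (hn : M.St n) : P n := by
  refine (hP n).1 (M.ind_st φ e ?_ (fun a h ha => ?_) n hn)
  · rw [M.ev_zero, hP]; exact h0
  · rw [M.app_succ, hP]; exact hs a h ((hP a).1 ha)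

/-! ### Recursion equations and the semiring laws -/

@[simp] theorem pred_zero : M.pred 0 = 0 := by
  simp [← M.app_predT M.nilEnv, predT]
@[simp] theorem pred_S (a : M.N) : M.pred (M.S a) = a := by
  simp [← M.app_predT M.nilEnv, predT]

theorem add_zero' (a : M.N) : a + 0 = a := by
  simp [← M.app_addT M.nilEnv, addT]
theorem add_S (a b : M.N) : a + M.S b = M.S (a + b) := by
  rw [← M.app_addT M.nilEnv, ← M.app_addT M.nilEnv]
  simp only [addT, ev_lam', ev_app', app_recN, ev_var', push_vz, push_vs, recn_succ, app_succ]
  exact congrArg (fun z => M.S (M.recn b a z)) (M.lam_lam_congr fun x n => by simp)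
theorem mul_zero' (a : M.N) : a * 0 = 0 := by
  simp [← M.app_mulT M.nilEnv, mulT]
theorem mul_S (a b : M.N) : a * M.S b = a * b + a := by
  rw [← M.app_mulT M.nilEnv, ← M.app_mulT M.nilEnv]
  simp only [mulT, ev_lam', ev_app', app_recN, ev_var', push_vz, push_vs, recn_succ, app_addT,
    ev_zero]
  exact congrArg (fun z => M.recn b 0 z + a) (M.lam_lam_congr fun x n => by simp)
theorem sub_zero' (a : M.N) : a - 0 = a := by
  simp [← M.app_subT M.nilEnv, subT]
theorem sub_S (a b : M.N) : a - M.S b = M.pred (a - b) := by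
  rw [← M.app_subT M.nilEnv, ← M.app_subT M.nilEnv]
  simp only [subT, ev_lam', ev_app', app_recN, ev_var', push_vz, push_vs, recn_succ, app_predT]
  exact congrArg (fun z => M.pred (M.recn b a z)) (M.lam_lam_congr fun x n => by simp)

theorem zero_add' (a : M.N) : 0 + a = a := by
  refine M.induction (.eq (addT ⬝ .zero ⬝ v0) v0) M.nilEnv (P := fun a => 0 + a = a)
    (fun n => by simp [Str.Sat]) ?_ (fun n ih => ?_) a
  · exact M.add_zero' 0
  · rw [M.add_S, ih]

theorem S_add (a b : M.N) : M.S a + b = M.S (a + b) := by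
  refine M.induction (.eq (addT ⬝ (.succ ⬝ v1) ⬝ v0) (.succ ⬝ (addT ⬝ v1 ⬝ v0))) (Str.push a M.nilEnv) (P := fun b => M.S a + b = M.S (a + b))
    (fun n => by simp [Str.Sat]) ?_ (fun n ih => ?_) b
  · rw [M.add_zero', M.add_zero']
  · rw [M.add_S, ih, M.add_S]

theorem add_comm' (a b : M.N) : a + b = b + a := by
  refine M.induction (.eq (addT ⬝ v1 ⬝ v0) (addT ⬝ v0 ⬝ v1)) (Str.push a M.nilEnv) (P := fun b => a + b = b + a)
    (fun n => by simp [Str.Sat]) ?_ (fun n ih => ?_) b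
  · rw [M.add_zero', M.zero_add']
  · rw [M.add_S, ih, M.S_add]

theorem add_assoc' (a b c : M.N) : a + b + c = a + (b + c) := by
  refine M.induction (.eq (addT ⬝ (addT ⬝ v2 ⬝ v1) ⬝ v0) (addT ⬝ v2 ⬝ (addT ⬝ v1 ⬝ v0))) (Str.push b (Str.push a M.nilEnv)) (P := fun c => a + b + c = a + (b + c))
    (fun n => by simp [Str.Sat]) ?_ (fun n ih => ?_) c
  · rw [M.add_zero', M.add_zero']
  · rw [M.add_S, ih, M.add_S, M.add_S]

theorem zero_mul' (a : M.N) : 0 * a = 0 := by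
  refine M.induction (.eq (mulT ⬝ .zero ⬝ v0) .zero) M.nilEnv (P := fun a => 0 * a = 0)
    (fun n => by simp [Str.Sat]) ?_ (fun n ih => ?_) a
  · exact M.mul_zero' 0
  · rw [M.mul_S, ih, M.add_zero']

theorem S_mul (a b : M.N) : M.S a * b = a * b + b := by
  refine M.induction (.eq (mulT ⬝ (.succ ⬝ v1) ⬝ v0) (addT ⬝ (mulT ⬝ v1 ⬝ v0) ⬝ v0)) (Str.push a M.nilEnv) (P := fun b => M.S a * b = a * b + b)
    (fun n => by simp [Str.Sat]) ?_ (fun n ih => ?_) b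
  · rw [M.mul_zero', M.mul_zero', M.add_zero']
  · rw [M.mul_S, ih, M.mul_S, M.add_S, M.add_S, M.add_assoc', M.add_comm' n a, M.add_assoc']

theorem mul_comm' (a b : M.N) : a * b = b * a := by
  refine M.induction (.eq (mulT ⬝ v1 ⬝ v0) (mulT ⬝ v0 ⬝ v1)) (Str.push a M.nilEnv) (P := fun b => a * b = b * a)
    (fun n => by simp [Str.Sat]) ?_ (fun n ih => ?_) b
  · rw [M.mul_zero', M.zero_mul']
  · rw [M.mul_S, ih, M.S_mul]

theorem mul_add' (a b c : M.N) : a * (b + c) = a * b + a * c := by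
  refine M.induction (.eq (mulT ⬝ v2 ⬝ (addT ⬝ v1 ⬝ v0))
    (addT ⬝ (mulT ⬝ v2 ⬝ v1) ⬝ (mulT ⬝ v2 ⬝ v0))) (Str.push b (Str.push a M.nilEnv)) (P := fun c => a * (b + c) = a * b + a * c)
    (fun n => by simp [Str.Sat]) ?_ (fun n ih => ?_) c
  · rw [M.add_zero', M.mul_zero', M.add_zero']
  · rw [M.add_S, M.mul_S, ih, M.mul_S, M.add_assoc']

theorem mul_assoc' (a b c : M.N) : a * b * c = a * (b * c) := by
  refine M.induction (.eq (mulT ⬝ (mulT ⬝ v2 ⬝ v1) ⬝ v0) (mulT ⬝ v2 ⬝ (mulT ⬝ v1 ⬝ v0))) (Str.push b (Str.push a M.nilEnv)) (P := fun c => a * b * c = a * (b * c))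
    (fun n => by simp [Str.Sat]) ?_ (fun n ih => ?_) c
  · rw [M.mul_zero', M.mul_zero', M.mul_zero']
  · rw [M.mul_S, ih, M.mul_S, M.mul_add']

theorem mul_one' (a : M.N) : a * 1 = a := by
  change a * M.S 0 = a
  rw [M.mul_S, M.mul_zero', M.zero_add']

instance : CommSemiring M.N where
  add_assoc := M.add_assoc'
  zero_add := M.zero_add'
  add_zero := M.add_zero'
  add_comm := M.add_comm'
  nsmul := nsmulRec
  left_distrib := M.mul_add'
  right_distrib a b c := by rw [M.mul_comm', M.mul_add', M.mul_comm' c a, M.mul_comm' c b]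
  zero_mul := M.zero_mul'
  mul_zero := M.mul_zero'
  mul_assoc := M.mul_assoc'
  one_mul a := by rw [M.mul_comm', M.mul_one']
  mul_one := M.mul_one'
  npow := npowRec
  mul_comm := M.mul_comm'

theorem S_eq (a : M.N) : M.S a = a + 1 := by
  change _ = a + M.S 0
  rw [M.add_S, add_zero]

theorem eq_zero_or_S (a : M.N) : a = 0 ∨ ∃ b, a = M.S b := by
  refine M.induction (.disj (.eq v0 .zero) (.ex ty0 (.eq v1 (.succ ⬝ v0)))) M.nilEnv (P := fun a => a = 0 ∨ ∃ b, a = M.S b) (fun n => by simp [Str.Sat]) ?_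
    (fun n _ => ?_) a
  · exact .inl rfl
  · exact .inr ⟨n, rfl⟩

theorem zero_sub' (a : M.N) : 0 - a = 0 := by
  refine M.induction (.eq (subT ⬝ .zero ⬝ v0) .zero) M.nilEnv (P := fun a => 0 - a = 0)
    (fun n => by simp [Str.Sat]) ?_ (fun n ih => ?_) a
  · exact M.sub_zero' 0
  · rw [M.sub_S, ih, M.pred_zero]

theorem S_sub_S (a b : M.N) : M.S a - M.S b = a - b := by
  refine M.induction (.eq (subT ⬝ (.succ ⬝ v1) ⬝ (.succ ⬝ v0)) (subT ⬝ v1 ⬝ v0)) (Str.push a M.nilEnv) (P := fun b => M.S a - M.S b = a - b)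
    (fun n => by simp [Str.Sat]) ?_ (fun n ih => ?_) b
  · rw [M.sub_S, M.sub_zero', M.sub_zero', M.pred_S]
  · rw [M.sub_S, ih, M.sub_S]

theorem add_sub_self (a b : M.N) : a + b - a = b := by
  refine M.induction (.eq (subT ⬝ (addT ⬝ v0 ⬝ v1) ⬝ v0) v1) (Str.push b M.nilEnv) (P := fun a => a + b - a = b)
    (fun n => by simp [Str.Sat]) ?_ (fun n ih => ?_) a
  · rw [M.sub_zero', zero_add]
  · rw [M.S_add, M.S_sub_S, ih]

theorem self_sub_add (a b : M.N) : a - (a + b) = 0 := by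
  refine M.induction (.eq (subT ⬝ v0 ⬝ (addT ⬝ v0 ⬝ v1)) .zero) (Str.push b M.nilEnv) (P := fun a => a - (a + b) = 0)
    (fun n => by simp [Str.Sat]) ?_ (fun n ih => ?_) a
  · exact M.zero_sub' _
  · rw [M.S_add, M.S_sub_S, ih]

theorem add_left_cancel' {a b c : M.N} (h : a + b = a + c) : b = c := by
  rw [← M.add_sub_self a b, h, M.add_sub_self]

theorem exists_add_total (a b : M.N) : (∃ c, b = a + c) ∨ ∃ c, a = b + c := by
  refine M.induction (.disj (.ex ty0 (.eq v2 (addT ⬝ v1 ⬝ v0))) (.ex ty0 (.eq v1 (addT ⬝ v2 ⬝ v0))))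
    (Str.push b M.nilEnv)
    (P := fun a => (∃ c, b = a + c) ∨ ∃ c, a = b + c) (fun n => by simp [Str.Sat]) ?_
    (fun n ih => ?_) a
  · exact .inl ⟨b, (zero_add b).symm⟩
  · rcases ih with ⟨c, hc⟩ | ⟨c, hc⟩
    · rcases M.eq_zero_or_S c with rfl | ⟨d, rfl⟩
      · exact .inr ⟨1, by rw [hc, S_eq, add_zero]⟩
      · exact .inl ⟨d, by rw [hc, M.S_add, M.add_S]⟩
    · exact .inr ⟨M.S c, by rw [hc, M.add_S]⟩

/-- The order is defined by addition, which makes it canonical; `sub_eq_zero` links it to the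
truncated subtraction by which formulas express it. -/
noncomputable instance : LinearOrder M.N where
  le a b := ∃ c, b = a + c
  le_refl a := ⟨0, (add_zero a).symm⟩
  le_trans := by
    rintro a _ _ ⟨c, rfl⟩ ⟨d, rfl⟩
    exact ⟨c + d, add_assoc _ _ _⟩
  le_antisymm := by
    rintro a _ ⟨c, rfl⟩ ⟨d, hd⟩
    rw [add_assoc] at hd
    have h : 0 = c + d := M.add_left_cancel' ((add_zero a).trans hd)
    rcases M.eq_zero_or_S c with rfl | ⟨c, rfl⟩
    · rw [add_zero]
    · rw [M.S_add] at h
      exact absurd h.symm (M.S_ne_zero _)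
  le_total := M.exists_add_total
  toDecidableLE := Classical.decRel _

instance : CanonicallyOrderedAdd M.N where
  exists_add_of_le h := h
  le_add_self _ b := ⟨b, add_comm _ _⟩
  le_self_add _ b := ⟨b, rfl⟩

theorem mul_pos' {a b : M.N} (ha : a ≠ 0) (hb : b ≠ 0) : a * b ≠ 0 := by
  rcases M.eq_zero_or_S a with rfl | ⟨a, rfl⟩
  · exact absurd rfl ha
  rcases M.eq_zero_or_S b with rfl | ⟨b, rfl⟩
  · exact absurd rfl hb
  rw [M.mul_S, M.add_S]
  exact M.S_ne_zero _

instance : IsOrderedCancelAddMonoid M.N where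
  add_le_add_left := by
    rintro a _ ⟨c, rfl⟩ d
    exact ⟨c, add_right_comm _ _ _⟩
  le_of_add_le_add_left := by
    rintro a b c ⟨d, hd⟩
    rw [add_assoc] at hd
    exact ⟨d, M.add_left_cancel' hd⟩

theorem zero_le' (a : M.N) : 0 ≤ a := ⟨a, (zero_add a).symm⟩

theorem mul_lt_mul' (a : M.N) (ha : 0 < a) (b c : M.N) (h : b < c) : a * b < a * c := by
  obtain ⟨d, rfl⟩ := h.le
  have hd : d ≠ 0 := by rintro rfl; simp at h
  refine lt_of_le_of_ne ⟨a * d, mul_add _ _ _⟩ fun h' => M.mul_pos' ha.ne' hd ?_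
  rw [mul_add] at h'
  exact (M.add_left_cancel' ((add_zero _).trans h')).symm

instance : IsStrictOrderedRing M.N where
  exists_pair_ne := ⟨0, 1, (M.S_ne_zero 0).symm⟩
  zero_le_one := M.zero_le' 1
  mul_lt_mul_of_pos_left := fun a ha b c h => M.mul_lt_mul' a ha b c h
  mul_lt_mul_of_pos_right := fun a ha b c h => by
    simpa only [mul_comm] using M.mul_lt_mul' a ha b c h

theorem sub_eq_zero {a b : M.N} : a - b = 0 ↔ a ≤ b := by
  constructor
  · intro h
    rcases M.exists_add_total a b with h' | ⟨c, rfl⟩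
    · exact h'
    · rw [M.add_sub_self] at h
      rw [h, add_zero]
  · rintro ⟨c, rfl⟩
    exact M.self_sub_add a c

theorem S_le_iff {a b : M.N} : M.S a ≤ b ↔ a < b := by
  rw [S_eq]
  constructor
  · rintro ⟨c, rfl⟩
    refine lt_of_le_of_ne ⟨1 + c, add_assoc _ _ _⟩ fun h => ?_
    rw [add_assoc] at h
    have := M.add_left_cancel' ((add_zero a).trans h)
    rw [add_comm, ← S_eq] at this
    exact M.S_ne_zero _ this.symm
  · intro h
    obtain ⟨c, rfl⟩ := h.le
    rcases M.eq_zero_or_S c with rfl | ⟨c, rfl⟩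
    · simp at h
    · exact ⟨c, by rw [S_eq]; ring⟩

theorem lt_S_iff {a b : M.N} : a < M.S b ↔ a ≤ b := by
  rw [← not_le, S_le_iff, not_lt]

end Model

end SysP

namespace SysP

/-! ## The ordered field of fractions of an ordered semiring -/

section Fractions

variable (N : Type) [CommSemiring N] [LinearOrder N] [IsStrictOrderedRing N]

/-- Pairs with the same difference. -/
def diffSetoid : Setoid (N × N) where
  r a b := a.1 + b.2 = b.1 + a.2
  iseqv := by
    refine ⟨fun a => rfl, fun h => h.symm, fun {a b c} h h' => ?_⟩
    refine add_right_cancel (b := b.2) ?_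
    linear_combination h + h'

/-- Formal differences. -/
def Diff : Type := Quotient (diffSetoid N)

variable {N}

/-- The difference of two elements. -/
def Diff.mk (a b : N) : Diff N := Quotient.mk (diffSetoid N) (a, b)

theorem Diff.mk_eq {a b c d : N} : Diff.mk a b = Diff.mk c d ↔ a + d = c + b := Quotient.eq

theorem Diff.ind {P : Diff N → Prop} (h : ∀ a b, P (Diff.mk a b)) (x : Diff N) : P x :=
  Quotient.ind (fun p => h p.1 p.2) x

instance : Zero (Diff N) := ⟨Diff.mk 0 0⟩
instance : One (Diff N) := ⟨Diff.mk 1 0⟩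
instance : Add (Diff N) := ⟨Quotient.map₂ (fun a b => (a.1 + b.1, a.2 + b.2)) (by
  intro a b (h : a.1 + b.2 = b.1 + a.2) c d (h' : c.1 + d.2 = d.1 + c.2)
  show (a.1 + c.1) + (b.2 + d.2) = (b.1 + d.1) + (a.2 + c.2)
  linear_combination h + h')⟩
instance : Neg (Diff N) := ⟨Quotient.map (fun a => (a.2, a.1)) (by
  intro a b (h : a.1 + b.2 = b.1 + a.2)
  show a.2 + b.1 = b.2 + a.1
  linear_combination -h)⟩
instance : Mul (Diff N) := ⟨Quotient.map₂
  (fun a b => (a.1 * b.1 + a.2 * b.2, a.1 * b.2 + a.2 * b.1)) (by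
  intro a b (h : a.1 + b.2 = b.1 + a.2) c d (h' : c.1 + d.2 = d.1 + c.2)
  show (a.1 * c.1 + a.2 * c.2) + (b.1 * d.2 + b.2 * d.1) =
    (b.1 * d.1 + b.2 * d.2) + (a.1 * c.2 + a.2 * c.1)
  refine add_right_cancel (b := b.2 * c.1 + b.1 * c.2) ?_
  linear_combination h * c.1 + b.1 * h' - h * c.2 - b.2 * h')⟩

theorem Diff.add_mk (a b c d : N) : Diff.mk a b + Diff.mk c d = Diff.mk (a + c) (b + d) := rfl
theorem Diff.mul_mk (a b c d : N) :
    Diff.mk a b * Diff.mk c d = Diff.mk (a * c + b * d) (a * d + b * c) := rfl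
theorem Diff.neg_mk (a b : N) : -Diff.mk a b = Diff.mk b a := rfl
theorem Diff.zero_def : (0 : Diff N) = Diff.mk 0 0 := rfl
theorem Diff.one_def : (1 : Diff N) = Diff.mk 1 0 := rfl

instance : CommRing (Diff N) where
  add_assoc x y z := by
    induction x using Diff.ind; induction y using Diff.ind; induction z using Diff.ind
    simp only [Diff.add_mk, Diff.mk_eq]; ring
  zero_add x := by
    induction x using Diff.ind
    simp only [Diff.zero_def, Diff.add_mk, Diff.mk_eq]; ring
  add_zero x := by
    induction x using Diff.ind
    simp only [Diff.zero_def, Diff.add_mk, Diff.mk_eq]; ring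
  add_comm x y := by
    induction x using Diff.ind; induction y using Diff.ind
    simp only [Diff.add_mk, Diff.mk_eq]; ring
  neg_add_cancel x := by
    induction x using Diff.ind
    simp only [Diff.zero_def, Diff.add_mk, Diff.neg_mk, Diff.mk_eq]; ring
  nsmul := nsmulRec
  zsmul := zsmulRec
  left_distrib x y z := by
    induction x using Diff.ind; induction y using Diff.ind; induction z using Diff.ind
    simp only [Diff.add_mk, Diff.mul_mk, Diff.mk_eq]; ring
  right_distrib x y z := by
    induction x using Diff.ind; induction y using Diff.ind; induction z using Diff.ind
    simp only [Diff.add_mk, Diff.mul_mk, Diff.mk_eq]; ring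
  zero_mul x := by
    induction x using Diff.ind
    simp only [Diff.zero_def, Diff.mul_mk, Diff.mk_eq]; ring
  mul_zero x := by
    induction x using Diff.ind
    simp only [Diff.zero_def, Diff.mul_mk, Diff.mk_eq]; ring
  mul_assoc x y z := by
    induction x using Diff.ind; induction y using Diff.ind; induction z using Diff.ind
    simp only [Diff.mul_mk, Diff.mk_eq]; ring
  one_mul x := by
    induction x using Diff.ind
    simp only [Diff.one_def, Diff.mul_mk, Diff.mk_eq]; ring
  mul_one x := by
    induction x using Diff.ind
    simp only [Diff.one_def, Diff.mul_mk, Diff.mk_eq]; ring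
  npow := npowRec
  mul_comm x y := by
    induction x using Diff.ind; induction y using Diff.ind
    simp only [Diff.mul_mk, Diff.mk_eq]; ring

/-- The embedding of the semiring. -/
def Diff.of : N →+* Diff N where
  toFun a := Diff.mk a 0
  map_zero' := rfl
  map_one' := rfl
  map_add' a b := by simp only [Diff.add_mk, Diff.mk_eq]; ring
  map_mul' a b := by simp only [Diff.mul_mk, Diff.mk_eq]; ring

theorem Diff.of_injective : Function.Injective (Diff.of : N → Diff N) := fun a b h => by
  have : a + 0 = b + 0 := Diff.mk_eq.1 h
  simpa using this

instance : Nontrivial (Diff N) := Diff.of_injective.nontrivial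

variable (N) in
/-- The field of fractions of the differences. -/
abbrev Frac : Type := FractionRing (Diff N)

namespace Frac

/-- The embedding of the semiring in the field. -/
noncomputable def of : N →+* Frac N := (algebraMap (Diff N) (Frac N)).comp Diff.of

theorem of_injective : Function.Injective (of : N → Frac N) :=
  (IsFractionRing.injective (Diff N) (Frac N)).comp Diff.of_injective

theorem of_ne_zero {a : N} (h : a ≠ 0) : of a ≠ 0 := (map_ne_zero_iff _ of_injective).2 h

end Frac

variable [CanonicallyOrderedAdd N]

theorem Diff.eq_of_or_neg (x : Diff N) : ∃ a, x = Diff.of a ∨ x = -Diff.of a := by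
  induction x using Diff.ind with
  | h a b =>
    rcases le_total b a with h | h
    · obtain ⟨c, rfl⟩ := exists_add_of_le h
      exact ⟨c, .inl (Diff.mk_eq.2 (by ring))⟩
    · obtain ⟨c, rfl⟩ := exists_add_of_le h
      exact ⟨c, .inr (Diff.mk_eq.2 (by ring))⟩

/-- Up to sign every difference lies in `N`, where a product vanishes only if a factor does. -/
instance : NoZeroDivisors (Diff N) where
  eq_zero_or_eq_zero_of_mul_eq_zero {x y} h := by
    obtain ⟨a, ha⟩ := x.eq_of_or_neg
    obtain ⟨b, hb⟩ := y.eq_of_or_neg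
    have h1 : Diff.of (a * b) = Diff.of 0 := by
      rw [map_mul, map_zero]
      rcases ha with rfl | rfl <;> rcases hb with rfl | rfl <;> simpa using h
    rcases mul_eq_zero.1 (Diff.of_injective h1) with rfl | rfl
    · left; rcases ha with rfl | rfl <;> simp
    · right; rcases hb with rfl | rfl <;> simp

instance : IsDomain (Diff N) := NoZeroDivisors.to_isDomain _

namespace Frac

theorem eq_div_or_neg (x : Frac N) : ∃ a d : N, d ≠ 0 ∧ (x = of a / of d ∨ x = -(of a / of d)) := by
  obtain ⟨y, z, hz, rfl⟩ := IsFractionRing.div_surjective (A := Diff N) x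
  have hz' := nonZeroDivisors.ne_zero hz
  obtain ⟨a, ha⟩ := y.eq_of_or_neg
  obtain ⟨d, hd⟩ := z.eq_of_or_neg
  refine ⟨a, d, ?_, ?_⟩
  · rintro rfl
    rcases hd with rfl | rfl <;> simp at hz'
  · rcases ha with rfl | rfl <;> rcases hd with rfl | rfl <;> simp [of, neg_div, div_neg]

variable (N) in
/-- The nonnegative fractions. -/
def cone : RingCone (Frac N) where
  carrier := {x | ∃ a d : N, d ≠ 0 ∧ x = of a / of d}
  mul_mem' := by
    rintro _ _ ⟨a, d, hd, rfl⟩ ⟨b, e, he, rfl⟩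
    exact ⟨a * b, d * e, mul_ne_zero hd he, by rw [map_mul, map_mul, div_mul_div_comm]⟩
  one_mem' := ⟨1, 1, one_ne_zero, by simp⟩
  add_mem' := by
    rintro _ _ ⟨a, d, hd, rfl⟩ ⟨b, e, he, rfl⟩
    refine ⟨a * e + d * b, d * e, mul_ne_zero hd he, ?_⟩
    rw [div_add_div _ _ (of_ne_zero hd) (of_ne_zero he)]
    simp only [map_mul, map_add]
  zero_mem' := ⟨0, 1, one_ne_zero, by simp⟩
  eq_zero_of_mem_of_neg_mem' := by
    rintro _ ⟨a, d, hd, rfl⟩ ⟨b, e, he, h⟩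
    have hd' := of_ne_zero hd
    have he' := of_ne_zero he
    have h1 : of (a * e + b * d) = of 0 := by
      simp only [map_mul, map_add, map_zero]
      field_simp at h
      linear_combination -h
    have h2 : a * e = 0 := (add_eq_zero.1 (of_injective h1)).1
    rw [(mul_eq_zero.1 h2).resolve_right he]
    simp

instance : HasMemOrNegMem (cone N) where
  mem_or_neg_mem x := by
    obtain ⟨a, d, hd, h⟩ := eq_div_or_neg x
    rcases h with rfl | rfl
    · exact .inl ⟨a, d, hd, rfl⟩
    · exact .inr ⟨a, d, hd, neg_neg _⟩

open Classical in
noncomputable instance : LinearOrder (Frac N) := .mkOfAddGroupCone (cone N)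

instance : IsOrderedRing (Frac N) := .mkOfCone (cone N)

instance : IsStrictOrderedRing (Frac N) := IsOrderedRing.toIsStrictOrderedRing _

theorem of_nonneg (a : N) : 0 ≤ of a := by
  change of a - 0 ∈ cone N
  exact ⟨a, 1, one_ne_zero, by simp⟩

theorem of_le {a b : N} : of a ≤ of b ↔ a ≤ b := by
  have key : ∀ {a b : N}, a ≤ b → of a ≤ of b := fun {a b} h => by
    obtain ⟨c, rfl⟩ := exists_add_of_le h
    rw [map_add]
    exact le_add_of_nonneg_right (of_nonneg c)
  refine ⟨fun h => ?_, key⟩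
  rcases le_total a b with h' | h'
  · exact h'
  · rw [of_injective (le_antisymm h (key h'))]

theorem of_lt {a b : N} : of a < of b ↔ a < b := by rw [← not_le, ← not_le, of_le]

/-- The field is Archimedean relative to `N` (not to `ℕ`): nonzero denominators are at least 1, so a
quotient is at most its numerator. -/
theorem exists_le_of (h1 : ∀ d : N, d ≠ 0 → 1 ≤ d) (x : Frac N) : ∃ a, x ≤ of a := by
  obtain ⟨a, d, hd, h⟩ := eq_div_or_neg x
  have hd' : (1 : Frac N) ≤ of d := by
    rw [← map_one of, of_le]
    exact h1 d hd
  rcases h with rfl | rfl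
  · exact ⟨a, div_le_self (of_nonneg a) hd'⟩
  · exact ⟨0, by
      rw [map_zero, neg_nonpos]
      exact div_nonneg (of_nonneg a) (of_nonneg d)⟩

end Frac

end Fractions

end SysP

namespace SysP

namespace Model

variable (M : Model) {Γ Δ : Ctx} {σ τ : Ty}

/-! ## Coded rational numbers in a model -/

/-- Powers of two. -/
def pow2 (a : M.N) : M.N := M.app (M.val pow2T) a
@[simp] theorem app_pow2T (e : M.Env Γ) (a : M.N) : M.app (M.ev pow2T e) a = M.pow2 a :=
  congrArg (M.app · a) (M.ev_closed pow2T e)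

/-- Triangular numbers. -/
def tri (a : M.N) : M.N := M.app (M.val triT) a
@[simp] theorem app_triT (e : M.Env Γ) (a : M.N) : M.app (M.ev triT e) a = M.tri a :=
  congrArg (M.app · a) (M.ev_closed triT e)

/-- The diagonal of a pair. -/
def diag (a : M.N) : M.N := M.app (M.val diagT) a
@[simp] theorem app_diagT (e : M.Env Γ) (a : M.N) : M.app (M.ev diagT e) a = M.diag a :=
  congrArg (M.app · a) (M.ev_closed diagT e)

/-- The second component. -/
def snd (a : M.N) : M.N := M.app (M.val sndT) a
@[simp] theorem app_sndT (e : M.Env Γ) (a : M.N) : M.app (M.ev sndT e) a = M.snd a :=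
  congrArg (M.app · a) (M.ev_closed sndT e)

/-- The first component. -/
def fst (a : M.N) : M.N := M.app (M.val fstT) a
@[simp] theorem app_fstT (e : M.Env Γ) (a : M.N) : M.app (M.ev fstT e) a = M.fst a :=
  congrArg (M.app · a) (M.ev_closed fstT e)

/-- The positive part of the numerator. -/
def numP (a : M.N) : M.N := M.app (M.val numPT) a
@[simp] theorem app_numPT (e : M.Env Γ) (a : M.N) : M.app (M.ev numPT e) a = M.numP a :=
  congrArg (M.app · a) (M.ev_closed numPT e)

/-- The negative part of the numerator. -/
def numM (a : M.N) : M.N := M.app (M.val numMT) a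
@[simp] theorem app_numMT (e : M.Env Γ) (a : M.N) : M.app (M.ev numMT e) a = M.numM a :=
  congrArg (M.app · a) (M.ev_closed numMT e)

/-- The denominator. -/
def den (a : M.N) : M.N := M.app (M.val denT) a
@[simp] theorem app_denT (e : M.Env Γ) (a : M.N) : M.app (M.ev denT e) a = M.den a :=
  congrArg (M.app · a) (M.ev_closed denT e)

/-- The code of an inverse power of two. -/
def invPow2 (a : M.N) : M.N := M.app (M.val invPow2QT) a
@[simp] theorem app_invPow2QT (e : M.Env Γ) (a : M.N) : M.app (M.ev invPow2QT e) a = M.invPow2 a :=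
  congrArg (M.app · a) (M.ev_closed invPow2QT e)

/-- The negative of a code. -/
def negQ (a : M.N) : M.N := M.app (M.val negQT) a
@[simp] theorem app_negQT (e : M.Env Γ) (a : M.N) : M.app (M.ev negQT e) a = M.negQ a :=
  congrArg (M.app · a) (M.ev_closed negQT e)

/-- The absolute value of a code. -/
def absQ (a : M.N) : M.N := M.app (M.val absQT) a
@[simp] theorem app_absQT (e : M.Env Γ) (a : M.N) : M.app (M.ev absQT e) a = M.absQ a :=
  congrArg (M.app · a) (M.ev_closed absQT e)

/-- The pairing function. -/
def pair (a b : M.N) : M.N := M.app (M.app (M.val pairT) a) b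
@[simp] theorem app_pairT (e : M.Env Γ) (a b : M.N) :
    M.app (M.app (M.ev pairT e) a) b = M.pair a b :=
  congrArg (fun f => M.app (M.app f a) b) (M.ev_closed pairT e)

/-- The sum of two codes. -/
def addQ (a b : M.N) : M.N := M.app (M.app (M.val addQT) a) b
@[simp] theorem app_addQT (e : M.Env Γ) (a b : M.N) :
    M.app (M.app (M.ev addQT e) a) b = M.addQ a b :=
  congrArg (fun f => M.app (M.app f a) b) (M.ev_closed addQT e)

/-- The distance of two codes. -/
def distQ (a b : M.N) : M.N := M.app (M.app (M.val distQT) a) b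
@[simp] theorem app_distQT (e : M.Env Γ) (a b : M.N) :
    M.app (M.app (M.ev distQT e) a) b = M.distQ a b :=
  congrArg (fun f => M.app (M.app f a) b) (M.ev_closed distQT e)

/-- Cross multiplication. -/
def cross (a b : M.N) : M.N := M.app (M.app (M.val crossT) a) b
@[simp] theorem app_crossT (e : M.Env Γ) (a b : M.N) :
    M.app (M.app (M.ev crossT e) a) b = M.cross a b :=
  congrArg (fun f => M.app (M.app f a) b) (M.ev_closed crossT e)

/-- The characteristic function of the order. -/
def leQ (a b : M.N) : M.N := M.app (M.app (M.val leQT) a) b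
@[simp] theorem app_leQT (e : M.Env Γ) (a b : M.N) :
    M.app (M.app (M.ev leQT e) a) b = M.leQ a b :=
  congrArg (fun f => M.app (M.app f a) b) (M.ev_closed leQT e)

/-- The characteristic function of the strict order. -/
def ltQ (a b : M.N) : M.N := M.app (M.app (M.val ltQT) a) b
@[simp] theorem app_ltQT (e : M.Env Γ) (a b : M.N) :
    M.app (M.app (M.ev ltQT e) a) b = M.ltQ a b :=
  congrArg (fun f => M.app (M.app f a) b) (M.ev_closed ltQT e)

/-- The code with the given numerator and denominator. -/
def mkQ (p m d : M.N) : M.N := M.app (M.app (M.app (M.val mkQT) p) m) d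
@[simp] theorem app_mkQT (e : M.Env Γ) (p m d : M.N) :
    M.app (M.app (M.app (M.ev mkQT e) p) m) d = M.mkQ p m d :=
  congrArg (fun f => M.app (M.app (M.app f p) m) d) (M.ev_closed mkQT e)

/-- Bounded quantification. -/
def ball (k : M.N) (p : M.Carrier ty1) : M.N := M.app (M.app (M.val ballT) k) p
@[simp] theorem app_ballT (e : M.Env Γ) (k : M.N) (p : M.Carrier ty1) :
    M.app (M.app (M.ev ballT e) k) p = M.ball k p :=
  congrArg (fun f => M.app (M.app f k) p) (M.ev_closed ballT e)

/-- The test for fast convergence. -/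
def good (q : M.Carrier ty1) (n : M.N) : M.N := M.app (M.app (M.val goodT) q) n
@[simp] theorem app_goodT (e : M.Env Γ) (q : M.Carrier ty1) (n : M.N) :
    M.app (M.app (M.ev goodT e) q) n = M.good q n :=
  congrArg (fun f => M.app (M.app f q) n) (M.ev_closed goodT e)

/-- The hat function. -/
def hat (q : M.Carrier ty1) (n : M.N) : M.N := M.app (M.app (M.val hatT) q) n
@[simp] theorem app_hatT (e : M.Env Γ) (q : M.Carrier ty1) (n : M.N) :
    M.app (M.app (M.ev hatT e) q) n = M.hat q n :=
  congrArg (fun f => M.app (M.app f q) n) (M.ev_closed hatT e)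

open Classical in
@[simp] theorem app_ifT (e : M.Env Γ) (p : M.N) (x y : M.Carrier σ) :
    M.app (M.app (M.app (M.ev (ifT σ) e) p) x) y = if p = 0 then x else y := by
  rcases M.eq_zero_or_S p with rfl | ⟨p, rfl⟩
  · simp [ifT]
  · simp [ifT, M.S_ne_zero]

@[simp] theorem S_eq_zero (a : M.N) : M.S a = 0 ↔ False := iff_false_intro (M.S_ne_zero a)

@[simp] theorem sat_leF (a b : Tm Γ ty0) (e : M.Env Γ) :
    M.Sat (leF a b) e ↔ M.ev a e ≤ M.ev b e := by
  simp [leF, Str.Sat, M.sub_eq_zero]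

/-! ### Powers of two, bounded quantification and Cantor pairing -/

theorem pow2_zero : M.pow2 0 = 1 := by
  rw [← M.app_pow2T M.nilEnv]; simp [pow2T]; rfl

theorem pow2_S (n : M.N) : M.pow2 (M.S n) = M.pow2 n + M.pow2 n := by
  rw [← M.app_pow2T M.nilEnv, ← M.app_pow2T M.nilEnv]
  simp only [pow2T, ev_lam', ev_app', app_recN, ev_var', push_vz, push_vs, recn_succ, app_succ,
    app_addT, ev_zero]
  exact congrArg (fun z => M.recn n (M.S 0) z + M.recn n (M.S 0) z)
    (M.lam_lam_congr fun x n => by simp)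

theorem lt_pow2 (n : M.N) : n < M.pow2 n := by
  rw [← S_le_iff]
  refine M.induction (leF (.succ ⬝ v0) (pow2T ⬝ v0)) M.nilEnv (P := fun n => M.S n ≤ M.pow2 n)
    (fun n => by simp) ?_ (fun n ih => ?_) n (by simp [Fm.Internal, leF])
  · rw [pow2_zero]; exact le_rfl
  · rw [pow2_S, M.S_eq (M.S n)]
    refine add_le_add ih (le_trans ?_ ih)
    rw [S_eq]
    exact le_add_self

theorem pow2_ne_zero (n : M.N) : M.pow2 n ≠ 0 :=
  ((M.zero_le' n).trans_lt (M.lt_pow2 n)).ne'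

theorem ball_zero (p : M.Carrier ty1) : M.ball 0 p = M.app p 0 := by
  rw [← M.app_ballT M.nilEnv]; simp [ballT]

theorem ball_S (k : M.N) (p : M.Carrier ty1) :
    M.ball (M.S k) p = M.ball k p + M.app p (M.S k) := by
  rw [← M.app_ballT M.nilEnv, ← M.app_ballT M.nilEnv]
  simp only [ballT, ev_lam', ev_app', app_recN, ev_var', push_vz, push_vs, recn_succ, app_succ,
    app_addT, ev_zero]
  exact congrArg (fun z => M.recn k (M.app p 0) z + M.app p (M.S k))
    (M.lam_lam_congr fun x n => by simp)

theorem le_S_iff {a b : M.N} : a ≤ M.S b ↔ a ≤ b ∨ a = M.S b := by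
  rw [le_iff_lt_or_eq, lt_S_iff]

theorem ball_eq_zero (k : M.N) (p : M.Carrier ty1) :
    M.ball k p = 0 ↔ ∀ i ≤ k, M.app p i = 0 := by
  refine M.induction (.conj
    (.imp (.eq (ballT ⬝ v0 ⬝ v1) .zero) (.all ty0 (.imp (leF v0 v1) (.eq (v2 ⬝ v0) .zero))))
    (.imp (.all ty0 (.imp (leF v0 v1) (.eq (v2 ⬝ v0) .zero))) (.eq (ballT ⬝ v0 ⬝ v1) .zero)))
    (Str.push p M.nilEnv) (P := fun k => M.ball k p = 0 ↔ ∀ i ≤ k, M.app p i = 0)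
    (fun n => by simp [Str.Sat, iff_iff_implies_and_implies]) ?_ (fun k ih => ?_) k
    (by simp [Fm.Internal, leF])
  · rw [ball_zero]
    refine ⟨fun h i hi => ?_, fun h => h 0 le_rfl⟩
    rw [le_antisymm hi (M.zero_le' i), h]
  · rw [ball_S, add_eq_zero, ih]
    constructor
    · rintro ⟨h1, h2⟩ i hi
      rcases M.le_S_iff.1 hi with h | rfl
      exacts [h1 i h, h2]
    · exact fun h => ⟨fun i hi => h i (M.le_S_iff.2 (.inl hi)), h _ le_rfl⟩

theorem tri_zero : M.tri 0 = 0 := by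
  rw [← M.app_triT M.nilEnv]; simp [triT]

theorem tri_S (n : M.N) : M.tri (M.S n) = M.tri n + M.S n := by
  rw [← M.app_triT M.nilEnv, ← M.app_triT M.nilEnv]
  simp only [triT, ev_lam', ev_app', app_recN, ev_var', push_vz, push_vs, recn_succ, app_succ,
    app_addT, ev_zero]
  exact congrArg (fun z => M.recn n 0 z + M.S n) (M.lam_lam_congr fun x n => by simp)

theorem diag_zero : M.diag 0 = 0 := by
  rw [← M.app_diagT M.nilEnv]; simp [diagT]

open Classical in
theorem diag_S (n : M.N) : M.diag (M.S n) =
    if M.tri (M.S (M.diag n)) ≤ M.S n then M.S (M.diag n) else M.diag n := by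
  -- `diag n`, with its step function placed in the environment that arises from unfolding `diag (S
  -- n)`.
  have h : M.diag n = M.recn n 0 (M.ev (.lam (.lam (ifT ty0 ⬝ (subT ⬝ (triT ⬝ (.succ ⬝ v1)) ⬝
      (.succ ⬝ v0)) ⬝ (.succ ⬝ v1) ⬝ v1))) (Str.push (M.S n) M.nilEnv)) := by
    rw [← M.app_diagT M.nilEnv]
    simp only [diagT, ev_lam', ev_app', app_recN, ev_var', push_vz, ev_zero]
    exact congrArg (fun z => M.recn n 0 z) (M.lam_lam_congr fun x n => by simp)
  rw [← M.app_diagT M.nilEnv (M.S n)]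
  simp only [diagT, ev_lam', ev_app', app_recN, ev_var', push_vz, push_vs, recn_succ, app_succ,
    app_ifT, app_subT, app_triT, ev_zero, ← h, sub_eq_zero]

/-- The search for the diagonal may advance by at most one per step because consecutive triangular
numbers differ by at least 1. -/
theorem tri_diag (z : M.N) : M.tri (M.diag z) ≤ z ∧ z < M.tri (M.S (M.diag z)) := by
  refine M.induction (.conj (leF (triT ⬝ (diagT ⬝ v0)) v0)
    (leF (.succ ⬝ v0) (triT ⬝ (.succ ⬝ (diagT ⬝ v0))))) M.nilEnv
    (P := fun z => M.tri (M.diag z) ≤ z ∧ z < M.tri (M.S (M.diag z)))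
    (fun n => by simp [Str.Sat, S_le_iff]) ?_ (fun z ih => ?_) z (by simp [Fm.Internal, leF])
  · rw [diag_zero, tri_S, tri_zero, zero_add]
    exact ⟨le_rfl, M.lt_S_iff.2 le_rfl⟩
  · rw [diag_S]
    split_ifs with h
    · refine ⟨h, ?_⟩
      rw [tri_S]
      refine (M.S_le_iff.2 ih.2).trans_lt (lt_add_of_pos_right _ ?_)
      exact M.lt_S_iff.2 (M.zero_le' _)
    · exact ⟨ih.1.trans (M.lt_S_iff.1 (M.lt_S_iff.2 (M.lt_S_iff.2 le_rfl).le)), not_le.1 h⟩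

theorem tri_mono {a b : M.N} (h : a ≤ b) : M.tri a ≤ M.tri b := by
  obtain ⟨c, rfl⟩ := h
  refine M.induction (leF (triT ⬝ v1) (triT ⬝ (addT ⬝ v1 ⬝ v0))) (Str.push a M.nilEnv)
    (P := fun c => M.tri a ≤ M.tri (a + c)) (fun n => by simp) ?_ (fun c ih => ?_) c
    (by simp [Fm.Internal, leF])
  · rw [add_zero]
  · rw [add_S, tri_S]
    exact ih.trans le_self_add

theorem diag_eq {w z : M.N} (h1 : M.tri w ≤ z) (h2 : z < M.tri (M.S w)) : M.diag z = w := by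
  obtain ⟨h3, h4⟩ := M.tri_diag z
  refine le_antisymm ?_ ?_ <;> refine not_lt.1 fun h => ?_
  · exact absurd (h2.trans_le ((M.tri_mono (M.S_le_iff.2 h)).trans h3)) (lt_irrefl _)
  · exact absurd (h4.trans_le ((M.tri_mono (M.S_le_iff.2 h)).trans h1)) (lt_irrefl _)

theorem pair_eq (x y : M.N) : M.pair x y = M.tri (x + y) + y := by
  rw [← M.app_pairT M.nilEnv]; simp [pairT]

theorem diag_pair (x y : M.N) : M.diag (M.pair x y) = x + y := by
  rw [pair_eq]
  refine M.diag_eq le_self_add ?_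
  rw [tri_S]
  exact add_lt_add_right (M.lt_S_iff.2 le_add_self) _

theorem snd_pair (x y : M.N) : M.snd (M.pair x y) = y := by
  rw [← M.app_sndT M.nilEnv]
  simp only [sndT, ev_lam', ev_app', app_subT, ev_var', push_vz, app_triT, app_diagT, diag_pair]
  rw [pair_eq, add_sub_self]

theorem fst_pair (x y : M.N) : M.fst (M.pair x y) = x := by
  rw [← M.app_fstT M.nilEnv]
  simp only [fstT, ev_lam', ev_app', app_subT, ev_var', push_vz, app_sndT, app_diagT, diag_pair,
    snd_pair]
  rw [add_comm, add_sub_self]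

/-! ### Codes and their values in the field of fractions -/

theorem numP_eq (q : M.N) : M.numP q = M.fst (M.fst q) := by
  rw [← M.app_numPT M.nilEnv]; simp [numPT]

theorem numM_eq (q : M.N) : M.numM q = M.snd (M.fst q) := by
  rw [← M.app_numMT M.nilEnv]; simp [numMT]

theorem den_eq (q : M.N) : M.den q = M.S (M.snd q) := by
  rw [← M.app_denT M.nilEnv]; simp [denT]

theorem den_ne_zero (q : M.N) : M.den q ≠ 0 := by rw [den_eq]; exact M.S_ne_zero _

theorem mkQ_eq (p m d : M.N) : M.mkQ p m d = M.pair (M.pair p m) (M.pred d) := by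
  rw [← M.app_mkQT M.nilEnv]; simp [mkQT]

/-- The fractions of a model. -/
abbrev K : Type := Frac M.N

/-- The embedding of the numbers in the fractions. -/
noncomputable abbrev ι : M.N →+* M.K := Frac.of

theorem one_le_of_ne_zero (d : M.N) (h : d ≠ 0) : 1 ≤ d :=
  M.S_le_iff.2 (lt_of_le_of_ne (M.zero_le' d) h.symm)

theorem ι_pos {d : M.N} (h : d ≠ 0) : 0 < M.ι d :=
  lt_of_le_of_ne (Frac.of_nonneg d) (Frac.of_ne_zero h).symm

theorem ι_S (a : M.N) : M.ι (M.S a) = M.ι a + 1 := by rw [S_eq, map_add, map_one]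

/-- The rational number with a given code. -/
noncomputable def rv (q : M.N) : M.K := (M.ι (M.numP q) - M.ι (M.numM q)) / M.ι (M.den q)

theorem rv_mkQ (p m d : M.N) (hd : d ≠ 0) : M.rv (M.mkQ p m d) = (M.ι p - M.ι m) / M.ι d := by
  rw [rv, numP_eq, numM_eq, den_eq, mkQ_eq, fst_pair, snd_pair, fst_pair, snd_pair]
  rcases M.eq_zero_or_S d with rfl | ⟨d, rfl⟩
  · exact absurd rfl hd
  · rw [pred_S]

theorem rv_zeroQ (e : M.Env Γ) : M.rv (M.ev zeroQT e) = 0 := by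
  simp [zeroQT, rv_mkQ]

theorem rv_oneQ (e : M.Env Γ) : M.rv (M.ev oneQT e) = 1 := by
  simp [oneQT, rv_mkQ, ι_S]

/-- Inverse powers of two. -/
noncomputable def eps (n : M.N) : M.K := 1 / M.ι (M.pow2 n)

theorem eps_pos (n : M.N) : 0 < M.eps n := div_pos one_pos (M.ι_pos (M.pow2_ne_zero n))

theorem eps_S (n : M.N) : M.eps n = 2 * M.eps (M.S n) := by
  have := (M.ι_pos (M.pow2_ne_zero n)).ne'
  rw [eps, eps, pow2_S, map_add]
  field_simp
  ring

theorem eps_zero : M.eps 0 = 1 := by rw [eps, pow2_zero, map_one, div_one]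

theorem exists_eps_lt {x : M.K} (hx : 0 < x) : ∃ n, M.eps n < x := by
  obtain ⟨n, hn⟩ := Frac.exists_le_of M.one_le_of_ne_zero (1 / x)
  refine ⟨n, ?_⟩
  rw [eps, one_div_lt (M.ι_pos (M.pow2_ne_zero n)) hx]
  exact hn.trans_lt (Frac.of_lt.2 (M.lt_pow2 n))

theorem rv_invPow2 (n : M.N) : M.rv (M.invPow2 n) = M.eps n := by
  rw [← M.app_invPow2QT M.nilEnv]
  simp [invPow2QT, rv_mkQ, M.pow2_ne_zero, eps, ι_S]

theorem rv_addQ (q r : M.N) : M.rv (M.addQ q r) = M.rv q + M.rv r := by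
  have hq := (M.ι_pos (M.den_ne_zero q)).ne'
  have hr := (M.ι_pos (M.den_ne_zero r)).ne'
  rw [← M.app_addQT M.nilEnv]
  simp only [addQT, ev_lam', ev_app', ev_var', push_vz, push_vs, app_mkQT, app_addT, app_mulT,
    app_numPT, app_numMT, app_denT]
  rw [M.rv_mkQ _ _ _ (mul_ne_zero (M.den_ne_zero q) (M.den_ne_zero r)), rv, rv]
  simp only [map_add, map_mul]
  field_simp
  ring

theorem rv_negQ (q : M.N) : M.rv (M.negQ q) = -M.rv q := by
  rw [← M.app_negQT M.nilEnv]
  simp only [negQT, ev_lam', ev_app', ev_var', push_vz, app_mkQT, app_numPT, app_numMT, app_denT]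
  rw [M.rv_mkQ _ _ _ (M.den_ne_zero q), rv, ← neg_div, neg_sub]

theorem rv_absQ (q : M.N) : M.rv (M.absQ q) = |M.rv q| := by
  have hq := M.ι_pos (M.den_ne_zero q)
  rw [← M.app_absQT M.nilEnv]
  simp only [absQT, ev_lam', ev_app', ev_var', push_vz, app_ifT, app_subT, app_numPT, app_numMT,
    app_negQT, sub_eq_zero]
  split_ifs with h
  · rw [abs_of_nonneg]
    exact div_nonneg (sub_nonneg.2 (Frac.of_le.2 h)) hq.le
  · rw [rv_negQ, abs_of_nonpos]
    exact div_nonpos_of_nonpos_of_nonneg (sub_nonpos.2 (Frac.of_le.2 (not_le.1 h).le)) hq.le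

theorem rv_distQ (q r : M.N) : M.rv (M.distQ q r) = |M.rv q - M.rv r| := by
  rw [← M.app_distQT M.nilEnv]
  simp [distQT, rv_absQ, rv_addQ, rv_negQ, sub_eq_add_neg]

theorem ι_cross (q r : M.N) : M.ι (M.cross q r) =
    M.ι (M.numP q) * M.ι (M.den r) + M.ι (M.numM r) * M.ι (M.den q) := by
  rw [← M.app_crossT M.nilEnv]
  simp only [crossT, ev_lam', ev_app', ev_var', push_vz, push_vs, app_addT, app_mulT,
    app_numPT, app_numMT, app_denT, map_add, map_mul]

theorem leQ_eq_zero (q r : M.N) : M.leQ q r = 0 ↔ M.rv q ≤ M.rv r := by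
  rw [← M.app_leQT M.nilEnv]
  simp only [leQT, ev_lam', ev_app', ev_var', push_vz, push_vs, app_subT, app_crossT]
  rw [sub_eq_zero, ← Frac.of_le, ι_cross, ι_cross, rv, rv,
    div_le_div_iff₀ (M.ι_pos (M.den_ne_zero q)) (M.ι_pos (M.den_ne_zero r))]
  constructor <;> intro h <;> linarith

theorem ltQ_eq_zero (q r : M.N) : M.ltQ q r = 0 ↔ M.rv q < M.rv r := by
  rw [← M.app_ltQT M.nilEnv]
  simp only [ltQT, ev_lam', ev_app', ev_var', push_vz, push_vs, app_subT, app_crossT, app_succ]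
  rw [sub_eq_zero, S_le_iff, ← Frac.of_lt, ι_cross, ι_cross, rv, rv,
    div_lt_div_iff₀ (M.ι_pos (M.den_ne_zero q)) (M.ι_pos (M.den_ne_zero r))]
  constructor <;> intro h <;> linarith

/-! ## Real numbers in a model -/

@[simp] theorem sat_leQF (a b : Tm Γ ty0) (e : M.Env Γ) :
    M.Sat (leQF a b) e ↔ M.rv (M.ev a e) ≤ M.rv (M.ev b e) := by
  simp [leQF, Str.Sat, M.leQ_eq_zero]

theorem good_eq_zero (q : M.Carrier ty1) (n : M.N) : M.good q n = 0 ↔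
    ∀ b ≤ n, ∀ a ≤ b, |M.rv (M.app q a) - M.rv (M.app q b)| < M.eps a := by
  rw [← M.app_goodT M.nilEnv]
  simp [goodT, ball_eq_zero, ltQ_eq_zero, rv_distQ, rv_invPow2]

theorem hat_zero (q : M.Carrier ty1) : M.hat q 0 = M.app q 0 := by
  rw [← M.app_hatT M.nilEnv]; simp [hatT]

open Classical in
theorem hat_S (q : M.Carrier ty1) (n : M.N) : M.hat q (M.S n) =
    if M.good q (M.S n) = 0 then M.app q (M.S n) else M.hat q n := by
  rw [← M.app_hatT M.nilEnv, ← M.app_hatT M.nilEnv]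
  simp only [hatT, ev_lam', ev_app', app_recN, ev_var', push_vz, push_vs, recn_succ, app_succ,
    app_ifT, app_goodT, ev_zero]
  congr 1
  exact congrArg (fun z => M.recn n (M.app q 0) z) (M.lam_lam_congr fun x n => by simp)

theorem hat_of_good {q : M.Carrier ty1} {n : M.N} (h : M.good q n = 0) {i : M.N} (hi : i ≤ n) :
    M.hat q i = M.app q i := by
  rcases M.eq_zero_or_S i with rfl | ⟨i, rfl⟩
  · exact M.hat_zero q
  · rw [hat_S, if_pos]
    rw [good_eq_zero] at h ⊢
    exact fun b hb => h b (hb.trans hi)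

/-- If the test succeeds at `S b`, then `hat` agrees with `q` up to there and the test is the claim.
If it fails, the value at `S b` is the one at `b`, and the induction hypothesis applies. -/
theorem hat_regular (q : M.Carrier ty1) (b : M.N) :
    ∀ a ≤ b, |M.rv (M.hat q a) - M.rv (M.hat q b)| < M.eps a := by
  refine M.induction (.all ty0 (.imp (leF v0 v1) (.eq (ltQT ⬝ (distQT ⬝ (hatT ⬝ v2 ⬝ v0) ⬝
    (hatT ⬝ v2 ⬝ v1)) ⬝ (invPow2QT ⬝ v0)) .zero))) (Str.push q M.nilEnv)
    (P := fun b => ∀ a ≤ b, |M.rv (M.hat q a) - M.rv (M.hat q b)| < M.eps a)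
    (fun n => by simp [Str.Sat, ltQ_eq_zero, rv_distQ, rv_invPow2]) ?_ (fun b ih a hab => ?_) b
    (by simp [Fm.Internal, leF])
  · intro a ha
    rw [le_antisymm ha (M.zero_le' a), sub_self, abs_zero]
    exact M.eps_pos _
  · by_cases h : M.good q (M.S b) = 0
    · rw [M.hat_of_good h hab, M.hat_of_good h le_rfl]
      exact (M.good_eq_zero _ _).1 h _ le_rfl a hab
    · rcases M.le_S_iff.1 hab with h' | rfl
      · rw [hat_S, if_neg h]
        exact ih a h'
      · rw [sub_self, abs_zero]
        exact M.eps_pos _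

theorem hat_const {q : M.Carrier ty1} {r : M.N} (h : ∀ n, M.app q n = r) (n : M.N) :
    M.hat q n = r := by
  refine M.induction (.eq (hatT ⬝ v2 ⬝ v0) v1) (Str.push r (Str.push q M.nilEnv))
    (P := fun n => M.hat q n = r) (fun n => by simp [Str.Sat]) ?_ (fun n ih => ?_) n
  · rw [hat_zero, h]
  · rw [hat_S, h, ih, ite_self]

/-- The rational approximations of a real number. -/
noncomputable def apx (x : M.Carrier ty1) (n : M.N) : M.K := M.rv (M.hat x n)

theorem abs_apx_sub {x : M.Carrier ty1} {a b : M.N} (h : a ≤ b) :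
    |M.apx x a - M.apx x b| < M.eps a := M.hat_regular x b a h

/-- The order of the real numbers. -/
def LeR (x y : M.Carrier ty1) : Prop := ∀ n, M.apx x n ≤ M.apx y n + 2 * M.eps n

@[simp] theorem sat_leRF (x y : Tm Γ ty1) (e : M.Env Γ) :
    M.Sat (leRF x y) e ↔ M.LeR (M.ev x e) (M.ev y e) := by
  simp [leRF, Str.Sat, LeR, apx, rv_addQ, rv_invPow2, two_mul]

@[simp] theorem sat_distLeRF (x y : Tm Γ ty1) (k : Tm Γ ty0) (e : M.Env Γ) :
    M.Sat (distLeRF x y k) e ↔ ∀ n, |M.apx (M.ev x e) n - M.apx (M.ev y e) n| ≤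
      M.eps (M.ev k e) + 2 * M.eps n := by
  simp [distLeRF, Str.Sat, apx, rv_addQ, rv_distQ, rv_invPow2, two_mul]

theorem eps_anti {a b : M.N} (h : a ≤ b) : M.eps b ≤ M.eps a := by
  obtain ⟨c, rfl⟩ := h
  refine M.induction (leQF (invPow2QT ⬝ (addT ⬝ v1 ⬝ v0)) (invPow2QT ⬝ v1))
    (Str.push a M.nilEnv) (P := fun c => M.eps (a + c) ≤ M.eps a)
    (fun n => by simp [rv_invPow2]) ?_ (fun c ih => ?_) c (by simp [Fm.Internal, leQF])
  · rw [add_zero]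
  · have := M.eps_S (a + c)
    have := M.eps_pos (M.S (a + c))
    rw [add_S]
    linarith

theorem LeR.refl (x : M.Carrier ty1) : M.LeR x x := fun n => by
  have := M.eps_pos n
  linarith

/-- Composing at index `n` would double the error. At index `l + n` the two comparisons cost at most
`4 * eps l`, which is below any given gap, and returning to `n` costs `2 * eps n`. -/
theorem LeR.trans {x y z : M.Carrier ty1} (h : M.LeR x y) (h' : M.LeR y z) : M.LeR x z := by
  intro n
  refine le_of_not_gt fun hlt => ?_
  obtain ⟨l, hl⟩ := M.exists_eps_lt (x := (M.apx x n - (M.apx z n + 2 * M.eps n)) / 4) (by linarith)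
  have h1 := abs_lt.1 (M.abs_apx_sub (x := x) (le_add_self : n ≤ l + n))
  have h2 := abs_lt.1 (M.abs_apx_sub (x := z) (le_add_self : n ≤ l + n))
  have h3 := h (l + n)
  have h4 := h' (l + n)
  have h5 := M.eps_anti (le_self_add : l ≤ l + n)
  linarith

theorem LeR.of_le {c : M.Carrier (ty0 ⇒ ty1)} (h : ∀ n, M.LeR (M.app c n) (M.app c (M.S n)))
    {a b : M.N} (hab : a ≤ b) : M.LeR (M.app c a) (M.app c b) := by
  obtain ⟨d, rfl⟩ := hab
  refine M.induction (leRF (v1 ⬝ v2) (v1 ⬝ (addT ⬝ v2 ⬝ v0))) (Str.push c (Str.push a M.nilEnv))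
    (P := fun d => M.LeR (M.app c a) (M.app c (a + d))) (fun n => by simp) ?_ (fun d ih => ?_) d
    (by simp [Fm.Internal, leRF, leQF])
  · rw [add_zero]; exact LeR.refl M _
  · rw [add_S]; exact LeR.trans M ih (h _)

/-! ## Standard numbers -/

theorem st_val (t : CTm σ) : M.St (M.val t) := by
  have := M.st_closed t M.nilEnv
  rwa [M.ev_closed] at this

theorem st_app₁ (t : CTm (σ ⇒ τ)) {a : M.Carrier σ} (ha : M.St a) : M.St (M.app (M.val t) a) :=
  M.st_app _ _ (M.st_val t) ha

theorem st_zero : M.St (0 : M.N) := M.st_val .zero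

theorem st_S {a : M.N} (ha : M.St a) : M.St (M.S a) := M.st_app₁ .succ ha

/-- That standard numbers form an initial segment comes from external induction on the bound; the
induction formula mentions `st`. -/
theorem st_of_le {a b : M.N} (hab : a ≤ b) (hb : M.St b) : M.St a := by
  refine M.induction_st (.all ty0 (.imp (leF v0 v1) (.st v0))) M.nilEnv
    (P := fun b => ∀ a ≤ b, M.St a) (fun n => by simp [Str.Sat]) ?_ (fun b hb ih a hab => ?_) b hb
    a hab
  · intro a ha
    rw [le_antisymm ha (M.zero_le' a)]
    exact M.st_zero
  · rcases M.le_S_iff.1 hab with h | rfl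
    exacts [ih a h, M.st_S hb]

theorem lt_of_st {a b : M.N} (ha : M.St a) (hb : ¬ M.St b) : a < b :=
  not_le.1 fun h => hb (M.st_of_le h ha)

theorem exists_least (f : M.Carrier ty1) {m : M.N} (hm : M.app f m = 0) :
    ∃ n, M.app f n = 0 ∧ ∀ i < n, M.app f i ≠ 0 := by
  by_contra hcon
  push Not at hcon
  have key : ∀ n, ∀ i ≤ n, M.app f i ≠ 0 := by
    intro n
    refine M.induction (.all ty0 (.imp (leF v0 v1) (.neg (.eq (v2 ⬝ v0) .zero))))
      (Str.push f M.nilEnv) (P := fun n => ∀ i ≤ n, M.app f i ≠ 0)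
      (fun n => by simp [Str.Sat]) ?_ (fun n ih i hi h0 => ?_) n (by simp [Fm.Internal, leF])
    · intro i hi h0
      obtain ⟨j, hj, _⟩ := hcon i h0
      exact absurd (hj.trans_le (hi.trans (M.zero_le' j))) (lt_irrefl _)
    · obtain ⟨j, hj, hj0⟩ := hcon i h0
      exact ih j (M.lt_S_iff.1 (hj.trans_le hi)) hj0
  exact key m m le_rfl hm

/-! ## Transfer and monotone convergence in a model -/

/-- Transfer for a function. -/
def Trans (f : M.Carrier ty1) : Prop := (∀ n, M.St n → M.app f n ≠ 0) → ∀ n, M.app f n ≠ 0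

/-- Nonstandard monotone convergence for a sequence of real numbers. -/
def Mct (c : M.Carrier (ty0 ⇒ ty1)) : Prop :=
  (∀ n, M.LeR (M.app c n) (M.app c (M.S n)) ∧
    ∀ k, M.apx (M.app c (M.S n)) k ≤ 1 + 2 * M.eps k) →
  ∀ a b, ¬ M.St a → ¬ M.St b → ∀ k, M.St k → ∀ n,
    |M.apx (M.app c b) n - M.apx (M.app c a) n| ≤ M.eps k + 2 * M.eps n

@[simp] theorem sat_transF (f : Tm Γ ty1) (e : M.Env Γ) :
    M.Sat (transF f) e ↔ M.Trans (M.ev f e) := by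
  simp [transF, Str.Sat, Trans]

theorem apx_const {x : M.Carrier ty1} {r : M.N} (h : ∀ n, M.app x n = r) (n : M.N) :
    M.apx x n = M.rv r := by rw [apx, M.hat_const h]

@[simp] theorem sat_mctF (c : Tm Γ (ty0 ⇒ ty1)) (e : M.Env Γ) :
    M.Sat (mctF c) e ↔ M.Mct (M.ev c e) := by
  have h1 : ∀ (e : M.Env (ty0 :: Γ)) (n : M.N), M.apx (M.app (M.ev ratRT e) (M.ev oneQT e)) n = 1 :=
    fun e n => by rw [M.apx_const (r := M.ev oneQT e) (fun n => by simp [ratRT]), rv_oneQ]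
  simp [mctF, nearF, Str.Sat, Mct, LeR, h1]

/-- The geometric sum. -/
def geom (n : M.N) : M.N := M.app (M.val geomT) n

@[simp] theorem app_geomT (e : M.Env Γ) (n : M.N) : M.app (M.ev geomT e) n = M.geom n :=
  congrArg (M.app · n) (M.ev_closed geomT e)

theorem geom_zero : M.geom 0 = M.ev zeroQT M.nilEnv := by
  rw [← M.app_geomT M.nilEnv, geomT]
  simp only [ev_lam', ev_app', app_recN, ev_var', push_vz, recn_zero]
  exact M.ev_closed zeroQT _

theorem geom_S (n : M.N) : M.geom (M.S n) = M.addQ (M.geom n) (M.invPow2 (M.S n)) := by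
  rw [← M.app_geomT M.nilEnv, ← M.app_geomT M.nilEnv]
  simp only [geomT, ev_lam', ev_app', app_recN, ev_var', push_vz, push_vs, recn_succ, app_succ,
    app_addQT, app_invPow2QT]
  have h : ∀ e : M.Env [ty0], M.ev zeroQT e = M.val zeroQT := M.ev_closed zeroQT
  rw [h, h]
  exact congrArg (fun z => M.addQ (M.recn n (M.val zeroQT) z) (M.invPow2 (M.S n)))
    (M.lam_lam_congr fun x n => by simp)

theorem rv_geom (n : M.N) : M.rv (M.geom n) = 1 - M.eps n := by
  have h : M.rv (M.geom n) + M.eps n = 1 := by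
    -- Codes are not unique, so equality of values is expressed by two inequalities.
    refine M.induction (.conj (leQF (addQT ⬝ (geomT ⬝ v0) ⬝ (invPow2QT ⬝ v0)) oneQT)
      (leQF oneQT (addQT ⬝ (geomT ⬝ v0) ⬝ (invPow2QT ⬝ v0)))) M.nilEnv
      (P := fun n => M.rv (M.geom n) + M.eps n = 1)
      (fun n => by simp [Str.Sat, rv_addQ, rv_invPow2, rv_oneQ, le_antisymm_iff]) ?_
      (fun n ih => ?_) n (by simp [Fm.Internal, leQF])
    · rw [geom_zero, rv_zeroQ, eps_zero, zero_add]
    · rw [geom_S, rv_addQ, rv_invPow2]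
      have := M.eps_S n
      linarith
  linarith

open Classical in
theorem app_tT (f : M.Carrier ty1) (n : M.N) : M.rv (M.app (M.app (M.val tT) f) n) =
    if ∀ i ≤ n, M.app f i ≠ 0 then 0 else 1 - M.eps n := by
  -- The truncated difference `1 - f i` tested by `tT` is zero iff `f i ≠ 0`.
  have h : ∀ x : M.N, M.S 0 ≤ x ↔ x ≠ 0 := fun x => by
    rw [S_le_iff]
    exact ⟨fun h => h.ne', fun h => lt_of_le_of_ne (M.zero_le' x) h.symm⟩
  simp only [val, tT, ev_lam', ev_app', ev_var', push_vz, push_vs, app_ifT, app_ballT, app_geomT,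
    ball_eq_zero, app_subT, app_succ, ev_zero, sub_eq_zero, h]
  split_ifs
  · exact M.rv_zeroQ _
  · exact M.rv_geom n

/-- The least zero of `f` would be the place of a jump of `c` between two consecutive nonstandard
indices. -/
theorem trans_of_mct (f : M.Carrier ty1) (c : M.Carrier (ty0 ⇒ ty1))
    (hc : ∀ n k, M.app (M.app c n) k = M.app (M.app (M.val tT) f) n) (h : M.Mct c) :
    M.Trans f := by
  intro hst m hm
  obtain ⟨l, hl, hmin⟩ := M.exists_least f hm
  have hl' : ¬ M.St l := fun h => hst l h hl
  rcases M.eq_zero_or_S l with rfl | ⟨n, rfl⟩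
  · exact hl' M.st_zero
  have hn : ¬ M.St n := fun h => hl' (M.st_S h)
  have hapx : ∀ n k, M.apx (M.app c n) k = M.rv (M.app (M.app (M.val tT) f) n) := fun n k =>
    M.apx_const (hc n) k
  -- With `k = 1` and approximation index 3 the allowed distance is `1/2 + 2/8 = 3/4`, while the
  -- jump is at least `1 - 1/8`, as the nonstandard `S n` exceeds 3.
  have h1 := h (fun a => ⟨fun k => ?_, fun k => ?_⟩) n (M.S n) hn hl' (M.S 0) (M.st_S M.st_zero)
    (M.S (M.S (M.S 0)))
  · rw [hapx, hapx, app_tT, app_tT, if_neg fun h => h _ le_rfl hl,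
      if_pos fun i hi => hmin i (M.lt_S_iff.2 hi)] at h1
    have h2 := M.eps_anti (M.lt_of_st (M.st_S (M.st_S (M.st_S M.st_zero))) hl').le
    have h3 := M.eps_S 0
    have h4 := M.eps_S (M.S 0)
    have h5 := M.eps_S (M.S (M.S 0))
    rw [eps_zero] at h3
    have := le_abs_self (1 - M.eps (M.S n) - 0)
    linarith
  · have h1 := M.eps_pos k
    have h2 := M.eps_pos (M.S a)
    have h3 := M.eps_S a
    have h4 := M.eps_anti (M.zero_le' (M.S a))
    rw [eps_zero] at h4
    rw [hapx, hapx, app_tT, app_tT]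
    split_ifs with ha hb hb
    · linarith
    · linarith
    · exact absurd (fun i hi => hb i (hi.trans (M.lt_S_iff.2 le_rfl).le)) ha
    · linarith
  · have h1 := M.eps_pos k
    have h2 := M.eps_pos (M.S a)
    rw [hapx, app_tT]
    split_ifs <;> linarith

/-- The term `s`: `s c (q, p) n` is zero if `q` is less than the approximation of `c n` at `p`. -/
def sT : CTm ((ty0 ⇒ ty1) ⇒ ty0 ⇒ ty1) :=
  .lam (.lam (.lam (ltQT ⬝ (fstT ⬝ v1) ⬝ (hatT ⬝ (v2 ⬝ v0) ⬝ (sndT ⬝ v1)))))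

/-- Transfer for `s c (q, p)` in contrapositive form: that function has a zero at `n`, so it has a
standard one. The pair is standard because `q` and `p` are. -/
theorem exists_st_of_lt {c : M.Carrier (ty0 ⇒ ty1)}
    (h : ∀ n, M.St n → M.Trans (M.app (M.app (M.val sT) c) n)) {q p n : M.N} (hq : M.St q)
    (hp : M.St p) (hn : M.rv q < M.apx (M.app c n) p) :
    ∃ m, M.St m ∧ M.rv q < M.apx (M.app c m) p := by
  by_contra hcon
  push Not at hcon
  have hs : M.St (M.pair q p) := M.st_app _ _ (M.st_app₁ pairT hq) hp
  have key : ∀ m, M.app (M.app (M.app (M.val sT) c) (M.pair q p)) m = 0 ↔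
      M.rv q < M.apx (M.app c m) p := fun m => by
    simp [val, sT, ltQ_eq_zero, fst_pair, snd_pair, apx]
  refine h _ hs (fun m hm h0 => ?_) n ((key n).2 hn)
  exact absurd ((key m).1 h0) (not_lt.2 (hcon m hm))

/-- The grid argument: a gap above a nonstandard `a` would push `c a` past every standard grid
point, against the bound 1. The absolute value in `Mct` needs this for both orders of the indices.
-/
theorem mct_of_trans_aux {c : M.Carrier (ty0 ⇒ ty1)} (hst : M.St c)
    (h : ∀ n, M.St n → M.Trans (M.app (M.app (M.val sT) c) n))
    (hmono : ∀ n, M.LeR (M.app c n) (M.app c (M.S n)))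
    (hle : ∀ n k, M.apx (M.app c (M.S n)) k ≤ 1 + 2 * M.eps k)
    {a b : M.N} (ha : ¬ M.St a) {k : M.N} (hk : M.St k) (n : M.N) :
    M.apx (M.app c b) n - M.apx (M.app c a) n ≤ M.eps k + 2 * M.eps n := by
  refine le_of_not_gt fun hlt => ?_
  set p := M.S (M.S (M.S k))
  have hps : M.St p := M.st_S (M.st_S (M.st_S hk))
  have hkp : M.eps k = 8 * M.eps p := by
    rw [M.eps_S k, M.eps_S (M.S k), M.eps_S (M.S (M.S k))]; ring
  have hpp := M.eps_pos p
  -- The gap `8 * eps p + 2 * eps n` at index `n` is moved to index `p` through `p + n`: this costs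
  -- `2 * eps n` and then `2 * eps p`.
  have hgap : 6 * M.eps p < M.apx (M.app c b) p - M.apx (M.app c a) p := by
    have h1 := abs_lt.1 (M.abs_apx_sub (x := M.app c b) (le_add_self : n ≤ p + n))
    have h2 := abs_lt.1 (M.abs_apx_sub (x := M.app c a) (le_add_self : n ≤ p + n))
    have h3 := abs_lt.1 (M.abs_apx_sub (x := M.app c b) (le_self_add : p ≤ p + n))
    have h4 := abs_lt.1 (M.abs_apx_sub (x := M.app c a) (le_self_add : p ≤ p + n))
    linarith
  have hd := M.pow2_ne_zero p
  have hdpos := M.ι_pos hd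
  have hds : M.St (M.pow2 p) := M.st_app₁ pow2T hps
  -- The grid starts at minus the negative part of the numerator of the approximation of `c 0`; this
  -- is a lower bound since the denominator is at least 1, and it is standard since `c` and `p` are.
  obtain ⟨m, hms, hm⟩ : ∃ m, M.St m ∧ -(M.ι m / M.ι (M.pow2 p)) ≤ M.apx (M.app c 0) p := by
    have hq : M.St (M.hat (M.app c 0) p) :=
      M.st_app _ _ (M.st_app₁ hatT (M.st_app _ _ hst M.st_zero)) hps
    refine ⟨M.numM (M.hat (M.app c 0) p) * M.pow2 p,
      M.st_app _ _ (M.st_app₁ mulT (M.st_app₁ numMT hq)) hds, ?_⟩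
    rw [map_mul, mul_div_cancel_right₀ _ hdpos.ne', apx, rv, sub_div]
    have hden : 1 ≤ M.ι (M.den (M.hat (M.app c 0) p)) := by
      rw [← map_one M.ι, Frac.of_le]; exact M.one_le_of_ne_zero _ (M.den_ne_zero _)
    have h1 := div_le_self (Frac.of_nonneg (M.numM (M.hat (M.app c 0) p))) hden
    have h2 := div_nonneg (Frac.of_nonneg (M.numP (M.hat (M.app c 0) p))) (zero_le_one.trans hden)
    linarith
  have key : ∀ j, M.St j →
      (M.ι j - M.ι m) / M.ι (M.pow2 p) ≤ M.apx (M.app c a) p + 2 * M.eps p := by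
    intro j hj
    refine M.induction_st (leQF (mkQT ⬝ v0 ⬝ v1 ⬝ (pow2T ⬝ v2))
      (addQT ⬝ (hatT ⬝ (v3 ⬝ .var (.vs (.vs (.vs (.vs .vz))))) ⬝ v2) ⬝
        (addQT ⬝ (invPow2QT ⬝ v2) ⬝ (invPow2QT ⬝ v2))))
      (Str.push m (Str.push p (Str.push c (Str.push a M.nilEnv))))
      (P := fun j => (M.ι j - M.ι m) / M.ι (M.pow2 p) ≤ M.apx (M.app c a) p + 2 * M.eps p)
      (fun n => by simp [rv_mkQ, hd, rv_addQ, rv_invPow2, apx, two_mul]) ?_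
      (fun j hj ih => ?_) j hj
    · rw [map_zero, zero_sub, neg_div]
      exact hm.trans (LeR.of_le M hmono (M.zero_le' a) p)
    · have hq : M.St (M.mkQ (M.S j) m (M.pow2 p)) :=
        M.st_app _ _ (M.st_app _ _ (M.st_app₁ mkQT (M.st_S hj)) hms) hds
      have hstep : (M.ι (M.S j) - M.ι m) / M.ι (M.pow2 p) =
          (M.ι j - M.ι m) / M.ι (M.pow2 p) + M.eps p := by
        rw [ι_S, eps]; ring
      -- The next grid point is at most `3 * eps p` above the approximation of `c a`, hence below
      -- that of `c b`, so some standard `c i` exceeds it.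
      obtain ⟨i, his, hi⟩ := M.exists_st_of_lt h (n := b) hq hps (by
        rw [M.rv_mkQ _ _ _ hd, hstep]; linarith)
      rw [M.rv_mkQ _ _ _ hd] at hi
      exact hi.le.trans (LeR.of_le M hmono (M.lt_of_st his ha).le p)
  rcases M.eq_zero_or_S a with rfl | ⟨a, rfl⟩
  · exact ha M.st_zero
  -- This grid point is `1 + 5 * eps p`, whereas the bound on `c` allows only `1 + 2 * eps p`, plus
  -- the `2 * eps p` of `key`.
  have hend := key (m + M.pow2 p + M.S (M.S (M.S (M.S (M.S 0)))))
    (M.st_app _ _ (M.st_app₁ addT (M.st_app _ _ (M.st_app₁ addT hms) hds))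
      (M.st_S (M.st_S (M.st_S (M.st_S (M.st_S M.st_zero))))))
  have hb := hle a p
  simp only [map_add, ι_S, map_zero] at hend
  have : (M.ι m + M.ι (M.pow2 p) + (0 + 1 + 1 + 1 + 1 + 1) - M.ι m) / M.ι (M.pow2 p) =
      1 + 5 * M.eps p := by
    rw [eps]; field_simp; ring
  linarith

theorem mct_of_trans {c : M.Carrier (ty0 ⇒ ty1)} (hst : M.St c)
    (h : ∀ n, M.St n → M.Trans (M.app (M.app (M.val sT) c) n)) : M.Mct c := by
  intro hc a b ha hb k hk n
  have h1 := M.mct_of_trans_aux hst h (fun n => (hc n).1) (fun n => (hc n).2) ha hk n (b := b)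
  have h2 := M.mct_of_trans_aux hst h (fun n => (hc n).1) (fun n => (hc n).2) hb hk n (b := a)
  exact abs_le.2 ⟨by linarith, h1⟩

end Model

end SysP

theorem theorem2 :
    ∃ (s : SysP.CTm ((SysP.ty0 ⇒ SysP.ty1) ⇒ SysP.ty0 ⇒ SysP.ty1))
      (t : SysP.CTm (SysP.ty1 ⇒ SysP.ty1)),
      t = SysP.tT ∧
      SysP.ProvesP (SysP.mctToTrans t) ∧
      SysP.ProvesP (SysP.transToMct s) := by
  refine ⟨SysP.Model.sT, SysP.tT, rfl, SysP.provesP_of_sat fun M e f hf h => ?_,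
    SysP.provesP_of_sat fun M e c hc h => ?_⟩
  · rw [SysP.Model.sat_mctF] at h
    rw [SysP.Model.sat_transF, SysP.Model.ev_var']
    refine M.trans_of_mct _ _ (fun n k => ?_) h
    simp [SysP.ratSeqT, SysP.ratRT, SysP.Model.ev_closed]
  · rw [SysP.Model.sat_mctF, SysP.Model.ev_var']
    refine M.mct_of_trans ?_ fun n hn => ?_
    · simpa [SysP.Str.Sat] using hc
    · have := h n (by simpa [SysP.Str.Sat] using hn)
      simpa [SysP.Model.ev_closed] using this
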